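/- Throughout, $\mathbb N=\{1,2,3,\dots\}$ and $[t]$ is the integer part of $t$. Let $0<L_1<L$ and let $(P_\pm)$ be the problem of finding pairs $(\omega,u)$, $\omega<0$, $u$ real-valued, with $$-u''-u^3=\omega u,\qquad u\in H^2_{per}([0,L]),\qquad u(0)=\pm u(L_1)=\sqrt{2|\omega|},$$ where $H^2_{per}([0,L])=\{u\in H^2([0,L]):u(0)=u(L),\ u'(0)=u'(L)\}$. Let $\mathrm{cn}(\cdot\,;k)$ be the Jacobi elliptic cosine of modulus $k$, let $K(k)=\int_0^1\frac{dt}{\sqrt{(1-t^2)(1-k^2t^2)}}$, and for $k\in(1/\sqrt2,1)$ put $$S(k)=4\sqrt{2k^2-1}\,K(k),\qquad H(k)=\int_{\sqrt{(2k^2-1)/k^2}}^1\frac{dt}{\sqrt{(1-t^2)(1-k^2(1-t^2))}},\qquad \varphi(k)=\frac{H(k)}{K(k)}.$$ $S$ is an increasing bijection of $(1/\sqrt2,1)$ onto $(0,\infty)$ and $\varphi$ a decreasing bijection of $(1/\sqrt2,1)$ onto $(0,1)$; let $G=S\circ\varphi^{-1}$. For $n\in\mathbb N$ and $\omega<0$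 let $k_{n,\omega}=S^{-1}(L\sqrt{|\omega|}/n)$, $$c_{n,\omega}(x)=\sqrt{\tfrac{2|\omega|k_{n,\omega}^2}{2k_{n,\omega}^2-1}}\ \mathrm{cn}\Big(\sqrt{\tfrac{|\omega|}{2k_{n,\omega}^2-1}}\,x\,;k_{n,\omega}\Big),\qquad \gamma_{n,\omega}=\sqrt{\tfrac{2k_{n,\omega}^2-1}{|\omega|}}\,H(k_{n,\omega}),\qquad \tilde u^\pm_{n,\omega}(x)=c_{n,\omega}(x\pm\gamma_{n,\omega}).$$ For $n\in\mathbb N$ let $r_n=\frac{L_1}{L}n-\big[\frac{L_1}{L}n+\frac12\big]$, $\xi_n=2|r_n|$, $s_n^+=\frac{L}{2n}r_n$, $s_n^-=\frac{L}{2n}\big(|r_n|-\frac12\big)\,\mathrm{sgn}(r_n)$. When $\xi_n\in(0,1)$, let $\omega_n^\pm<0$ be given by $$\sqrt{|\omega_n^+|}=\frac nL\,G(\xi_n),\qquad \sqrt{|\omega_n^-|}=\frac nL\,G(1-\xi_n),\qquad\text{and}\quad u_n^\pm(x)=c_{n,\omega_n^\pm}(x-s_n^\pm).$$ Theorem. Suppose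 $L_1/L=p/q$ with $p,q\in\mathbb N$ coprime. The set of all solutions of $(P_+)$ is $$\{(\omega,\tilde u^\pm_{n,\omega}):\omega<0,\ n\in\mathbb N q\}\ \cup\ \{(\omega_n^+,u_n^+):n\in\mathbb N,\ n\notin\mathbb N q,\ np/q+1/2\notin\mathbb N\}.$$ The set of all solutions of $(P_-)$ is $$\{(\omega_n^-,u_n^-):n\in\mathbb N,\ n\notin\mathbb N q\}\quad\text{if } q \text{ is odd},$$ $$\{(\omega,\tilde u^\pm_{n,\omega}):\omega<0,\ n\in(2\mathbb N-1)q/2\}\ \cup\ \{(\omega_n^-,u_n^-):n\in\mathbb N,\ n\notin\mathbb N q/2\}\quad\text{if } q \text{ is even}.$$ -/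

import Mathlib

open Set MeasureTheory

noncomputable section

namespace DoubleBridge

/-! ### Jacobi elliptic functions and elliptic integrals (modulus `k`) -/

/-- Incomplete elliptic integral of the first kind
`F(φ; k) = ∫₀^φ dθ / √(1 - k² sin² θ)`. -/
def ellF (k φ : ℝ) : ℝ := ∫ θ in (0 : ℝ)..φ, 1 / √(1 - k ^ 2 * Real.sin θ ^ 2)

/-- Jacobi amplitude: the inverse of the bijection `φ ↦ F(φ; k)` of `ℝ` (for `0 ≤ k < 1`). -/
def jacobiAm (y k : ℝ) : ℝ := Function.invFun (ellF k) y

/-- Jacobi elliptic cosine `cn(y; k) = cos (am (y; k))`. -/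
def jacobiCn (y k : ℝ) : ℝ := Real.cos (jacobiAm y k)

/-- Complete elliptic integral of the first kind. -/
def ellK (k : ℝ) : ℝ := ∫ t in (0 : ℝ)..1, 1 / √((1 - t ^ 2) * (1 - k ^ 2 * t ^ 2))

/-- The range of the modulus, `(1/√2, 1)`. -/
def modulusRange : Set ℝ := Ioo (1 / √2) 1

/-- `S(k) = 4 √(2k² - 1) K(k)`, an increasing bijection of `(1/√2, 1)` onto `(0, ∞)`. -/
def S (k : ℝ) : ℝ := 4 * √(2 * k ^ 2 - 1) * ellK k

/-- The inverse of `S : (1/√2, 1) → (0, ∞)`. -/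
def SInv (y : ℝ) : ℝ := Function.invFunOn S modulusRange y

/-- `∫_{√((2k²-1)/k²)}^1 dt / √((1 - t²)(1 - k²(1 - t²)))`. -/
def shiftIntegral (k : ℝ) : ℝ :=
  ∫ t in (√((2 * k ^ 2 - 1) / k ^ 2))..1, 1 / √((1 - t ^ 2) * (1 - k ^ 2 * (1 - t ^ 2)))

/-- `φ(k)`, a decreasing bijection of `(1/√2, 1)` onto `(0, 1)`. -/
def phi (k : ℝ) : ℝ := shiftIntegral k / ellK k

/-- The inverse of `φ : (1/√2, 1) → (0, 1)`. -/
def phiInv (y : ℝ) : ℝ := Function.invFunOn phi modulusRange y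

/-- `G = S ∘ φ⁻¹ : (0, 1) → (0, ∞)`. -/
def G (y : ℝ) : ℝ := S (phiInv y)

/-! ### The boundary value problems -/

/-- `v` is the weak derivative of `u` on `(0, L)`. -/
def IsWeakDeriv (L : ℝ) (u v : ℝ → ℝ) : Prop :=
  ∀ η : ℝ → ℝ, ContDiff ℝ (⊤ : ℕ∞) η → HasCompactSupport η → tsupport η ⊆ Ioo 0 L →
    ∫ x in Ioo 0 L, u x * deriv η x = -∫ x in Ioo 0 L, v x * η x

/-- `u ∈ H²(0, L)` with weak derivatives `u' = v` and `u'' = w`. -/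
structure IsH2With (L : ℝ) (u v w : ℝ → ℝ) : Prop where
  memLp : MemLp u 2 (volume.restrict (Ioo 0 L))
  memLp_fst : MemLp v 2 (volume.restrict (Ioo 0 L))
  memLp_snd : MemLp w 2 (volume.restrict (Ioo 0 L))
  weakDeriv_fst : IsWeakDeriv L u v
  weakDeriv_snd : IsWeakDeriv L v w

/-- `u` is (the continuous representative of) an element of
`H²_per([0, L]) = {u ∈ H²([0, L]) : u(0) = u(L), u'(0) = u'(L)}`.
Such a `u` is `C¹` on `[0, L]`, so that the one-sided derivatives at the end points are genuine.
Only the values of `u` on `[0, L]` matter. -/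
structure IsH2Per (L : ℝ) (u : ℝ → ℝ) : Prop where
  continuousOn : ContinuousOn u (Icc 0 L)
  exists_weak : ∃ v w, IsH2With L u v w
  periodic : u 0 = u L
  periodic_deriv : derivWithin u (Icc 0 L) 0 = derivWithin u (Icc 0 L) L

/-- `-u'' - u³ = ω u` on `(0, L)` for `u ∈ H²(0, L)`. -/
def SolvesNLS (L ω : ℝ) (u : ℝ → ℝ) : Prop :=
  ∃ v w, IsH2With L u v w ∧ ∀ᵐ x ∂(volume.restrict (Ioo 0 L)), -w x - u x ^ 3 = ω * u x

/-- The problem `-u'' - u³ = ω u`, `u ∈ H²_per([0, L])`, `ω < 0`,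
`u(0) = ε u(L₁) = √(2|ω|)`, where `ε = 1` for `(P₊)` and `ε = -1` for `(P₋)`. -/
structure SolvesP (ε L L₁ ω : ℝ) (u : ℝ → ℝ) : Prop where
  neg : ω < 0
  mem : IsH2Per L u
  eqn : SolvesNLS L ω u
  left : u 0 = √(2 * |ω|)
  right : ε * u L₁ = √(2 * |ω|)

/-- A function on `[0, L]` obtained by restriction. -/
def onInterval (L : ℝ) (u : ℝ → ℝ) : Icc (0 : ℝ) L → ℝ := fun x => u x

/-- The set of all solutions `(ω, u)`, `u` a function on `[0, L]`, of `(P₊)`. -/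
def solutionsPplus (L L₁ : ℝ) : Set (ℝ × (Icc (0 : ℝ) L → ℝ)) :=
  {z | ∃ ω u, SolvesP 1 L L₁ ω u ∧ z = (ω, onInterval L u)}

/-- The set of all solutions `(ω, u)`, `u` a function on `[0, L]`, of `(P₋)`. -/
def solutionsPminus (L L₁ : ℝ) : Set (ℝ × (Icc (0 : ℝ) L → ℝ)) :=
  {z | ∃ ω u, SolvesP (-1) L L₁ ω u ∧ z = (ω, onInterval L u)}

/-! ### The explicit solutions -/

/-- `k_{n,ω} = S⁻¹(L √|ω| / n)`. -/
def kMod (L : ℝ) (n : ℕ) (ω : ℝ) : ℝ := SInv (L * √|ω| / n)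

/-- The cnoidal function of period `L / n` and frequency `ω`,
`√(2|ω|k²/(2k²-1)) cn(√(|ω|/(2k²-1)) x; k)` with `k = k_{n,ω}`. -/
def cnoidal (L : ℝ) (n : ℕ) (ω x : ℝ) : ℝ :=
  √(2 * |ω| * kMod L n ω ^ 2 / (2 * kMod L n ω ^ 2 - 1)) *
    jacobiCn (√(|ω| / (2 * kMod L n ω ^ 2 - 1)) * x) (kMod L n ω)

/-- The shift `γ_{n,ω}`. -/
def gammaShift (L : ℝ) (n : ℕ) (ω : ℝ) : ℝ :=
  √((2 * kMod L n ω ^ 2 - 1) / |ω|) * shiftIntegral (kMod L n ω)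

/-- The branch functions `ũ⁺_{n,ω}`. -/
def uTildePlus (L : ℝ) (n : ℕ) (ω x : ℝ) : ℝ := cnoidal L n ω (x + gammaShift L n ω)

/-- The branch functions `ũ⁻_{n,ω}`. -/
def uTildeMinus (L : ℝ) (n : ℕ) (ω x : ℝ) : ℝ := cnoidal L n ω (x - gammaShift L n ω)

/-- `r_n = (L₁/L) n - ⌊(L₁/L) n + 1/2⌋`. -/
def rSeq (L L₁ : ℝ) (n : ℕ) : ℝ := L₁ / L * n - ⌊L₁ / L * n + 1 / 2⌋

/-- `ξ_n = 2 |r_n|`. -/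
def xiSeq (L L₁ : ℝ) (n : ℕ) : ℝ := 2 * |rSeq L L₁ n|

/-- `ω_n⁺ < 0` with `√|ω_n⁺| = (n/L) G(ξ_n)`. -/
def omegaPlus (L L₁ : ℝ) (n : ℕ) : ℝ := -((n / L * G (xiSeq L L₁ n)) ^ 2)

/-- `ω_n⁻ < 0` with `√|ω_n⁻| = (n/L) G(1 - ξ_n)`. -/
def omegaMinus (L L₁ : ℝ) (n : ℕ) : ℝ := -((n / L * G (1 - xiSeq L L₁ n)) ^ 2)

/-- `s_n⁺ = (L/2n) r_n`. -/
def sPlus (L L₁ : ℝ) (n : ℕ) : ℝ := L / (2 * n) * rSeq L L₁ n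

/-- `s_n⁻ = (L/2n) (|r_n| - 1/2) sgn r_n`. -/
def sMinus (L L₁ : ℝ) (n : ℕ) : ℝ :=
  L / (2 * n) * (|rSeq L L₁ n| - 1 / 2) * Real.sign (rSeq L L₁ n)

/-- `u_n⁺`. -/
def uPlus (L L₁ : ℝ) (n : ℕ) (x : ℝ) : ℝ :=
  cnoidal L n (omegaPlus L L₁ n) (x - sPlus L L₁ n)

/-- `u_n⁻`. -/
def uMinus (L L₁ : ℝ) (n : ℕ) (x : ℝ) : ℝ :=
  cnoidal L n (omegaMinus L L₁ n) (x - sMinus L L₁ n)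

/-! ### Index sets; here `ℕ` in the mathematical notation means the positive integers -/

/-- The `n ≥ 1` with `n ∈ ℕ c`. -/
def multiples (c : ℝ) : Set ℕ := {n | 1 ≤ n ∧ ∃ m : ℕ, 1 ≤ m ∧ (n : ℝ) = m * c}

/-- The `n ≥ 1` with `n ∈ (2ℕ - 1) c`. -/
def oddMultiples (c : ℝ) : Set ℕ := {n | 1 ≤ n ∧ ∃ m : ℕ, 1 ≤ m ∧ (n : ℝ) = (2 * m - 1) * c}

/-- `{(ω, ũ^±_{n,ω}) : ω < 0, n ∈ A}`. -/
def branches (L : ℝ) (A : Set ℕ) : Set (ℝ × (Icc (0 : ℝ) L → ℝ)) :=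
  {z | ∃ n ∈ A, ∃ ω : ℝ, ω < 0 ∧
    (z = (ω, onInterval L (uTildePlus L n ω)) ∨ z = (ω, onInterval L (uTildeMinus L n ω)))}

/-- `{(ω_n⁺, u_n⁺) : n ∈ A}`. -/
def isolatedPlus (L L₁ : ℝ) (A : Set ℕ) : Set (ℝ × (Icc (0 : ℝ) L → ℝ)) :=
  {z | ∃ n ∈ A, z = (omegaPlus L L₁ n, onInterval L (uPlus L L₁ n))}

/-- `{(ω_n⁻, u_n⁻) : n ∈ A}`. -/
def isolatedMinus (L L₁ : ℝ) (A : Set ℕ) : Set (ℝ × (Icc (0 : ℝ) L → ℝ)) :=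
  {z | ∃ n ∈ A, z = (omegaMinus L L₁ n, onInterval L (uMinus L L₁ n))}

end DoubleBridge

end

open DoubleBridge

/-! For fixed ω < 0 the equation is an autonomous system in the phase plane of (u, u'), and the
condition at 0 puts the orbit at height √(2|ω|). A weak solution is classical because its second
derivative is a polynomial in the continuous function u (`SolvesNLS.exists_isClassicalSolution`). At
that height slope zero belongs to the solitary wave, which does not return to its starting value,
and every nonzero slope is realised by a cnoidal wave of some modulus (`exists_modulus_slope_sq`).
Uniqueness for the initial value problem then identifies u with a cnoidal wave shifted by plus or
minus `profileShift`, and periodicity forces L to be a whole number n of its periods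
(`IsClassicalSolution.exists_eq_cnoidal`).

What remains is the condition at L₁. In units of the half period L/(2n) the shift is t = ±φ(k)/2, so
0 < |t| < 1/2. The profile is even and takes equal values only at points that agree up to sign
modulo its period; changing its sign is translation by half a period. Hence the condition says that
L₁n/L + δ or L₁n/L + δ + t is an integer, with δ = 0 for the plus problem and δ = 1/2 for the minus
problem (`cnoidal_right_iff`). The first alternative does not involve ω and yields a whole branch.
The second fixes t in terms of `rSeq`, hence φ(k), and since φ and S are bijections it fixes ω
(`phi_kMod_eq_iff`): one isolated solution. For L₁/L = p/q the index sets are read off from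
divisibility, since `rSeq` is 0 or -1/2 exactly when L₁n/L or L₁n/L + 1/2 is an integer. -/

namespace DoubleBridge

/-! ### The incomplete elliptic integral and the amplitude -/

section Amplitude

variable {k : ℝ}

theorem one_sub_sq_mul_sin_sq_pos (hk : k ^ 2 < 1) (θ : ℝ) : 0 < 1 - k ^ 2 * Real.sin θ ^ 2 := by
  nlinarith [Real.sin_sq_le_one θ, sq_nonneg k, sq_nonneg (Real.sin θ)]

theorem continuous_ellF_integrand (hk : k ^ 2 < 1) :
    Continuous fun θ : ℝ => 1 / √(1 - k ^ 2 * Real.sin θ ^ 2) :=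
  Continuous.div (by fun_prop) (by fun_prop)
    fun θ => (Real.sqrt_pos.2 (one_sub_sq_mul_sin_sq_pos hk θ)).ne'

theorem hasDerivAt_ellF (hk : k ^ 2 < 1) (θ : ℝ) :
    HasDerivAt (ellF k) (1 / √(1 - k ^ 2 * Real.sin θ ^ 2)) θ :=
  intervalIntegral.integral_hasDerivAt_right
    ((continuous_ellF_integrand hk).intervalIntegrable _ _)
    ((continuous_ellF_integrand hk).stronglyMeasurableAtFilter _ _)
    (continuous_ellF_integrand hk).continuousAt

theorem one_le_ellF_integrand (hk : k ^ 2 < 1) (θ : ℝ) :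
    1 ≤ 1 / √(1 - k ^ 2 * Real.sin θ ^ 2) := by
  rw [le_div_iff₀ (Real.sqrt_pos.2 (one_sub_sq_mul_sin_sq_pos hk θ)), one_mul, Real.sqrt_le_iff]
  constructor <;> nlinarith [mul_nonneg (sq_nonneg k) (sq_nonneg (Real.sin θ))]

theorem ellF_strictMono (hk : k ^ 2 < 1) : StrictMono (ellF k) :=
  strictMono_of_deriv_pos fun θ => by
    rw [(hasDerivAt_ellF hk θ).deriv]
    exact lt_of_lt_of_le one_pos (one_le_ellF_integrand hk θ)

theorem continuous_ellF (hk : k ^ 2 < 1) : Continuous (ellF k) :=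
  continuous_iff_continuousAt.2 fun θ => (hasDerivAt_ellF hk θ).continuousAt

@[simp] theorem ellF_zero : ellF k 0 = 0 := by simp [ellF]

theorem ellF_neg (θ : ℝ) : ellF k (-θ) = -ellF k θ := by
  have h := intervalIntegral.integral_comp_neg (a := 0) (b := θ)
    (fun θ : ℝ => 1 / √(1 - k ^ 2 * Real.sin θ ^ 2))
  simp only [Real.sin_neg, neg_sq, neg_zero] at h
  rw [ellF, ellF, intervalIntegral.integral_symm, ← h]

theorem le_ellF (hk : k ^ 2 < 1) {θ : ℝ} (hθ : 0 ≤ θ) : θ ≤ ellF k θ := by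
  have h := intervalIntegral.integral_mono_on hθ (intervalIntegrable_const (μ := volume) (c := (1 : ℝ)))
    ((continuous_ellF_integrand hk).intervalIntegrable 0 θ)
    fun x _ => one_le_ellF_integrand hk x
  simpa [ellF] using h

theorem ellF_surjective (hk : k ^ 2 < 1) : Function.Surjective (ellF k) := by
  refine (continuous_ellF hk).surjective ?_ ?_
  · exact Filter.tendsto_atTop_mono' _
      ((Filter.eventually_ge_atTop 0).mono fun θ hθ => le_ellF hk hθ) Filter.tendsto_id
  · refine Filter.tendsto_atBot_mono' _
      ((Filter.eventually_le_atBot 0).mono fun θ hθ => ?_) Filter.tendsto_id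
    have := le_ellF hk (neg_nonneg.2 hθ)
    rw [ellF_neg] at this
    simpa using this

/-- The integrand has period π, so the interval from θ to θ + π may be moved to the one from -π/2 to
π/2, where oddness of `ellF` doubles the half integral. -/
theorem ellF_add_pi (hk : k ^ 2 < 1) (θ : ℝ) :
    ellF k (θ + Real.pi) = ellF k θ + 2 * ellF k (Real.pi / 2) := by
  have hc := continuous_ellF_integrand hk
  have hper : Function.Periodic (fun θ : ℝ => 1 / √(1 - k ^ 2 * Real.sin θ ^ 2)) Real.pi :=
    fun θ => by simp [Real.sin_add_pi]
  have h1 := hper.intervalIntegral_add_eq θ (-(Real.pi / 2))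
  have h2 := intervalIntegral.integral_add_adjacent_intervals
    (hc.intervalIntegrable (μ := volume) 0 θ) (hc.intervalIntegrable θ (θ + Real.pi))
  have h3 := intervalIntegral.integral_interval_sub_left
    (hc.intervalIntegrable (μ := volume) 0 (Real.pi / 2))
    (hc.intervalIntegrable (μ := volume) 0 (-(Real.pi / 2)))
  have h4 : -(Real.pi / 2) + Real.pi = Real.pi / 2 := by ring
  rw [h4] at h1
  have h5 := ellF_neg (k := k) (Real.pi / 2)
  simp only [ellF] at h5 ⊢
  linarith

theorem ellF_jacobiAm (hk : k ^ 2 < 1) (y : ℝ) : ellF k (jacobiAm y k) = y :=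
  Function.rightInverse_invFun (ellF_surjective hk) y

theorem jacobiAm_ellF (hk : k ^ 2 < 1) (θ : ℝ) : jacobiAm (ellF k θ) k = θ :=
  Function.leftInverse_invFun (ellF_strictMono hk).injective θ

theorem jacobiAm_eq_iff (hk : k ^ 2 < 1) {y θ : ℝ} : jacobiAm y k = θ ↔ y = ellF k θ :=
  ⟨fun h => by rw [← h, ellF_jacobiAm hk], fun h => by rw [h, jacobiAm_ellF hk]⟩

theorem jacobiAm_neg (hk : k ^ 2 < 1) (y : ℝ) : jacobiAm (-y) k = -jacobiAm y k := by
  rw [jacobiAm_eq_iff hk, ellF_neg, ellF_jacobiAm hk]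

theorem jacobiAm_add (hk : k ^ 2 < 1) (y : ℝ) :
    jacobiAm (y + 2 * ellF k (Real.pi / 2)) k = jacobiAm y k + Real.pi := by
  rw [jacobiAm_eq_iff hk, ellF_add_pi hk, ellF_jacobiAm hk]

theorem continuous_jacobiAm (hk : k ^ 2 < 1) : Continuous fun y => jacobiAm y k := by
  have h : (fun y => jacobiAm y k) =
      ((ellF_strictMono hk).orderIsoOfSurjective _ (ellF_surjective hk)).symm := by
    ext y
    rw [jacobiAm_eq_iff hk]
    exact (((ellF_strictMono hk).orderIsoOfSurjective _ (ellF_surjective hk)).apply_symm_apply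
      y).symm
  rw [h]
  exact OrderIso.continuous _

theorem hasDerivAt_jacobiAm (hk : k ^ 2 < 1) (y : ℝ) :
    HasDerivAt (fun y => jacobiAm y k) (√(1 - k ^ 2 * Real.sin (jacobiAm y k) ^ 2)) y := by
  have h := HasDerivAt.of_local_left_inverse (continuous_jacobiAm hk).continuousAt
    (hasDerivAt_ellF hk (jacobiAm y k))
    (one_div_ne_zero (Real.sqrt_pos.2 (one_sub_sq_mul_sin_sq_pos hk _)).ne')
    (Filter.Eventually.of_forall fun y => ellF_jacobiAm hk y)
  simpa using h

/-! ### The elliptic cosine -/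

/-- The derivative of the elliptic cosine. -/
noncomputable def jacobiCnDeriv (y k : ℝ) : ℝ :=
  -(Real.sin (jacobiAm y k) * √(1 - k ^ 2 * Real.sin (jacobiAm y k) ^ 2))

theorem hasDerivAt_jacobiCn (hk : k ^ 2 < 1) (y : ℝ) :
    HasDerivAt (fun y => jacobiCn y k) (jacobiCnDeriv y k) y := by
  have h := (hasDerivAt_jacobiAm hk y).cos
  simpa [jacobiCn, jacobiCnDeriv] using h

theorem hasDerivAt_jacobiCnDeriv (hk : k ^ 2 < 1) (y : ℝ) :
    HasDerivAt (fun y => jacobiCnDeriv y k)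
      ((2 * k ^ 2 - 1) * jacobiCn y k - 2 * k ^ 2 * jacobiCn y k ^ 3) y := by
  have ham := hasDerivAt_jacobiAm hk y
  have hpos := one_sub_sq_mul_sin_sq_pos hk (jacobiAm y k)
  have h := (ham.sin.mul
    ((((ham.sin.pow 2).const_mul (k ^ 2)).const_sub 1).sqrt hpos.ne')).neg
  refine h.congr_deriv ?_
  have hs := Real.sq_sqrt hpos.le
  have hc := Real.sin_sq_add_cos_sq (jacobiAm y k)
  have hs0 := (Real.sqrt_pos.2 hpos).ne'
  simp only [jacobiCn, Pi.pow_apply]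
  generalize √(1 - k ^ 2 * Real.sin (jacobiAm y k) ^ 2) = d at *
  generalize Real.sin (jacobiAm y k) = s at *
  generalize Real.cos (jacobiAm y k) = c at *
  have h1 : -(k ^ 2 * (((2 : ℕ) : ℝ) * s ^ (2 - 1) * (c * d))) / (2 * d) = -(k ^ 2 * s * c) := by
    field_simp
    simp
    ring
  rw [h1]
  linear_combination (-c) * hs + (2 * c * k ^ 2) * hc

/-- The first integral of the equation for cn; it gives the slope of the profile at a prescribed
height. -/
theorem jacobiCnDeriv_sq (hk : k ^ 2 < 1) (y : ℝ) :
    jacobiCnDeriv y k ^ 2 = (1 - jacobiCn y k ^ 2) * (1 - k ^ 2 * (1 - jacobiCn y k ^ 2)) := by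
  have hpos := one_sub_sq_mul_sin_sq_pos hk (jacobiAm y k)
  rw [jacobiCnDeriv, neg_sq, mul_pow, Real.sq_sqrt hpos.le, Real.sin_sq]
  rfl

theorem jacobiCn_neg (hk : k ^ 2 < 1) (y : ℝ) : jacobiCn (-y) k = jacobiCn y k := by
  simp [jacobiCn, jacobiAm_neg hk]

theorem jacobiCnDeriv_neg (hk : k ^ 2 < 1) (y : ℝ) :
    jacobiCnDeriv (-y) k = -jacobiCnDeriv y k := by
  simp [jacobiCnDeriv, jacobiAm_neg hk]

theorem jacobiCn_antiperiodic (hk : k ^ 2 < 1) :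
    Function.Antiperiodic (fun y => jacobiCn y k) (2 * ellF k (Real.pi / 2)) := fun y => by
  simp [jacobiCn, jacobiAm_add hk]

theorem jacobiCnDeriv_antiperiodic (hk : k ^ 2 < 1) :
    Function.Antiperiodic (fun y => jacobiCnDeriv y k) (2 * ellF k (Real.pi / 2)) := fun y => by
  simp [jacobiCnDeriv, jacobiAm_add hk, Real.sin_add_pi]

theorem jacobiAm_add_int_mul (hk : k ^ 2 < 1) (y : ℝ) (m : ℤ) :
    jacobiAm (y + m * (2 * ellF k (Real.pi / 2))) k = jacobiAm y k + m * Real.pi := by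
  induction m using Int.induction_on with
  | zero => simp
  | succ i ih =>
    have := jacobiAm_add hk (y + (i : ℤ) * (2 * ellF k (Real.pi / 2)))
    rw [ih] at this
    push_cast at this ⊢
    rw [add_mul, one_mul, ← add_assoc, this]
    ring
  | pred i ih =>
    have := jacobiAm_add hk (y + (-(i : ℤ) - 1 : ℤ) * (2 * ellF k (Real.pi / 2)))
    have h2 : y + (-(i : ℤ) - 1 : ℤ) * (2 * ellF k (Real.pi / 2)) + 2 * ellF k (Real.pi / 2) =
      y + (-(i : ℤ) : ℤ) * (2 * ellF k (Real.pi / 2)) := by push_cast; ring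
    rw [h2, ih] at this
    push_cast at this ⊢
    linarith

/-- The amplitude is an odd bijection that turns translation by 2K into translation by π, so the
description of equal cosines transfers to the arguments. -/
theorem jacobiCn_eq_iff (hk : k ^ 2 < 1) {y z : ℝ} :
    jacobiCn y k = jacobiCn z k ↔
      ∃ m : ℤ, z = y + m * (4 * ellF k (Real.pi / 2)) ∨
        z = -y + m * (4 * ellF k (Real.pi / 2)) := by
  rw [jacobiCn, jacobiCn, Real.cos_eq_cos_iff]
  refine exists_congr fun m => or_congr ?_ ?_
  · have h := jacobiAm_add_int_mul hk y (2 * m)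
    have h2 : 2 * (m : ℝ) * Real.pi + jacobiAm y k =
      jacobiAm (y + (2 * m : ℤ) * (2 * ellF k (Real.pi / 2))) k := by rw [h]; push_cast; ring
    rw [h2, jacobiAm_eq_iff hk, ellF_jacobiAm hk]
    push_cast
    rw [show (2 * (m : ℝ)) * (2 * ellF k (Real.pi / 2)) = m * (4 * ellF k (Real.pi / 2)) by ring]
  · have h := jacobiAm_add_int_mul hk (-y) (2 * m)
    have h2 : 2 * (m : ℝ) * Real.pi - jacobiAm y k =
      jacobiAm (-y + (2 * m : ℤ) * (2 * ellF k (Real.pi / 2))) k := by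
        rw [h, jacobiAm_neg hk]; push_cast; ring
    rw [h2, jacobiAm_eq_iff hk, ellF_jacobiAm hk]
    push_cast
    rw [show (2 * (m : ℝ)) * (2 * ellF k (Real.pi / 2)) = m * (4 * ellF k (Real.pi / 2)) by ring]

/-- The position on the orbit of `cn` determines the argument up to a period. -/
theorem eq_add_period_of_jacobiCn_eq (hk : k ^ 2 < 1) {y z : ℝ}
    (h : jacobiCn y k = jacobiCn z k) (h' : jacobiCnDeriv y k = jacobiCnDeriv z k) :
    ∃ m : ℤ, z = y + m * (4 * ellF k (Real.pi / 2)) := by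
  have hsq : Real.sin (jacobiAm y k) ^ 2 = Real.sin (jacobiAm z k) ^ 2 := by
    rw [Real.sin_sq, Real.sin_sq]
    simp only [jacobiCn] at h
    rw [h]
  have hsin : Real.sin (jacobiAm y k) = Real.sin (jacobiAm z k) := by
    simp only [jacobiCnDeriv, hsq, neg_inj] at h'
    exact mul_right_cancel₀ (Real.sqrt_pos.2 (one_sub_sq_mul_sin_sq_pos hk _)).ne' h'
  have hang : (jacobiAm z k : Real.Angle) = jacobiAm y k :=
    Real.Angle.cos_sin_inj h.symm hsin.symm
  obtain ⟨m, hm⟩ := Real.Angle.angle_eq_iff_two_pi_dvd_sub.1 hang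
  refine ⟨m, ?_⟩
  have h1 := jacobiAm_add_int_mul hk y (2 * m)
  have h2 : jacobiAm z k = jacobiAm (y + (2 * m : ℤ) * (2 * ellF k (Real.pi / 2))) k := by
    rw [h1]; push_cast; linarith
  rw [jacobiAm_eq_iff hk, ellF_jacobiAm hk] at h2
  rw [h2]; push_cast; ring

end Amplitude

/-! ### The complete integral and the shift integral -/

/-- Substitution t = sin θ. Working on open intervals avoids the singularity of the integrand at t =
1. -/
theorem ellK_eq_ellF {k : ℝ} : ellK k = ellF k (Real.pi / 2) := by
  have himg : Real.sin '' Ioo 0 (Real.pi / 2) = Ioo 0 1 := by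
    ext t
    constructor
    · rintro ⟨θ, ⟨h0, h1⟩, rfl⟩
      refine ⟨Real.sin_pos_of_pos_of_lt_pi h0 (by linarith [Real.pi_pos]), ?_⟩
      have := Real.sin_lt_sin_of_lt_of_le_pi_div_two (by linarith) le_rfl h1
      simpa using this
    · rintro ⟨h0, h1⟩
      exact ⟨Real.arcsin t, ⟨Real.arcsin_pos.2 h0, Real.arcsin_lt_pi_div_two.2 h1⟩,
        Real.sin_arcsin (by linarith) h1.le⟩
  have hinj : InjOn Real.sin (Ioo 0 (Real.pi / 2)) :=
    fun x hx y hy h =>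
    Real.injOn_sin ⟨by linarith [hx.1, Real.pi_pos], hx.2.le⟩
      ⟨by linarith [hy.1, Real.pi_pos], hy.2.le⟩ h
  have h := integral_image_eq_integral_abs_deriv_smul measurableSet_Ioo
    (fun x _ => (Real.hasDerivAt_sin x).hasDerivWithinAt) hinj
    (fun t => 1 / √((1 - t ^ 2) * (1 - k ^ 2 * t ^ 2)))
  rw [himg] at h
  rw [ellK, ellF, intervalIntegral.integral_of_le zero_le_one,
    intervalIntegral.integral_of_le (by positivity), integral_Ioc_eq_integral_Ioo,
    integral_Ioc_eq_integral_Ioo, h]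
  refine setIntegral_congr_fun measurableSet_Ioo fun θ hθ => ?_
  have hc : 0 < Real.cos θ := Real.cos_pos_of_mem_Ioo ⟨by linarith [hθ.1, Real.pi_pos], hθ.2⟩
  have : 1 - Real.sin θ ^ 2 = Real.cos θ ^ 2 := by rw [Real.cos_sq']
  simp only [smul_eq_mul]
  rw [this, Real.sqrt_mul (sq_nonneg _), Real.sqrt_sq hc.le, abs_of_pos hc]
  field_simp

/-- Substitution t = cos θ, again on open intervals. -/
theorem integral_eq_ellF_arccos {k c : ℝ} (hc0 : 0 ≤ c) (hc1 : c ≤ 1) :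
    ∫ t in c..1, 1 / √((1 - t ^ 2) * (1 - k ^ 2 * (1 - t ^ 2))) = ellF k (Real.arccos c) := by
  have hle : Real.arccos c ≤ Real.pi / 2 := Real.arccos_le_pi_div_two.2 hc0
  have himg : Real.cos '' Ioo 0 (Real.arccos c) = Ioo c 1 := by
    ext t
    constructor
    · rintro ⟨θ, ⟨h0, h1⟩, rfl⟩
      constructor
      · have := Real.cos_lt_cos_of_nonneg_of_le_pi h0.le (Real.arccos_le_pi c) h1
        rwa [Real.cos_arccos (by linarith) hc1] at this
      · have := Real.cos_lt_cos_of_nonneg_of_le_pi le_rfl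
          (by linarith [Real.pi_pos]) h0
        simpa using this
    · rintro ⟨h0, h1⟩
      exact ⟨Real.arccos t, ⟨Real.arccos_pos.2 h1,
        Real.strictAntiOn_arccos ⟨by linarith, hc1⟩ ⟨by linarith, h1.le⟩ h0⟩,
        Real.cos_arccos (by linarith) h1.le⟩
  have hinj : InjOn Real.cos (Ioo 0 (Real.arccos c)) :=
    fun x hx y hy h =>
    Real.injOn_cos ⟨hx.1.le, by linarith [hx.2, Real.pi_pos]⟩
      ⟨hy.1.le, by linarith [hy.2, Real.pi_pos]⟩ h
  have h := integral_image_eq_integral_abs_deriv_smul measurableSet_Ioo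
    (fun x _ => (Real.hasDerivAt_cos x).hasDerivWithinAt) hinj
    (fun t => 1 / √((1 - t ^ 2) * (1 - k ^ 2 * (1 - t ^ 2))))
  rw [himg] at h
  rw [ellF, intervalIntegral.integral_of_le hc1,
    intervalIntegral.integral_of_le (Real.arccos_nonneg c), integral_Ioc_eq_integral_Ioo,
    integral_Ioc_eq_integral_Ioo, h]
  refine setIntegral_congr_fun measurableSet_Ioo fun θ hθ => ?_
  have hs : 0 < Real.sin θ := Real.sin_pos_of_pos_of_lt_pi hθ.1 (by linarith [hθ.2, Real.pi_pos])
  have : 1 - Real.cos θ ^ 2 = Real.sin θ ^ 2 := by rw [Real.sin_sq]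
  simp only [smul_eq_mul]
  rw [this, Real.sqrt_mul (sq_nonneg _), Real.sqrt_sq hs.le, abs_neg, abs_of_pos hs]
  field_simp

/-! ### The functions `S` and `φ` of the modulus -/

theorem modulusRange_pos {k : ℝ} (hk : k ∈ modulusRange) : 0 < k :=
  lt_trans (by positivity) hk.1

theorem modulusRange_sq_lt {k : ℝ} (hk : k ∈ modulusRange) : k ^ 2 < 1 := by
  nlinarith [hk.2, modulusRange_pos hk]

theorem one_div_sqrt_two_sq : (1 / √2 : ℝ) ^ 2 = 1 / 2 := by
  rw [div_pow, Real.sq_sqrt (by norm_num)]; norm_num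

theorem half_lt_modulusRange_sq {k : ℝ} (hk : k ∈ modulusRange) : 1 / 2 < k ^ 2 := by
  rw [← one_div_sqrt_two_sq]
  exact pow_lt_pow_left₀ hk.1 (by positivity) two_ne_zero

theorem mem_modulusRange {k : ℝ} (h0 : 0 < k) (h1 : 1 / 2 < k ^ 2) (h2 : k ^ 2 < 1) :
    k ∈ modulusRange := by
  refine ⟨lt_of_pow_lt_pow_left₀ 2 h0.le ?_, by nlinarith⟩
  rwa [one_div_sqrt_two_sq]

theorem ellF_le_ellF_of_modulus_le {a b θ : ℝ} (ha : 0 ≤ a) (hab : a ≤ b) (hb : b ^ 2 < 1)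
    (hθ : 0 ≤ θ) : ellF a θ ≤ ellF b θ := by
  have hsq : a ^ 2 ≤ b ^ 2 := pow_le_pow_left₀ ha hab 2
  refine intervalIntegral.integral_mono_on hθ
    ((continuous_ellF_integrand (hsq.trans_lt hb)).intervalIntegrable _ _)
    ((continuous_ellF_integrand hb).intervalIntegrable _ _) fun x _ => ?_
  refine one_div_le_one_div_of_le (Real.sqrt_pos.2 (one_sub_sq_mul_sin_sq_pos hb x))
    (Real.sqrt_le_sqrt ?_)
  nlinarith [sq_nonneg (Real.sin x)]

theorem continuousOn_ellF_modulus {A : Set ℝ} (hA : ∀ k ∈ A, k ^ 2 < 1) {s : ℝ → ℝ}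
    (hs : ContinuousOn s A) : ContinuousOn (fun k => ellF k (s k)) A := by
  rw [continuousOn_iff_continuous_domRestrict] at hs ⊢
  refine intervalIntegral.continuous_parametric_intervalIntegral_of_continuous
    (f := fun (k : A) θ => 1 / √(1 - (k : ℝ) ^ 2 * Real.sin θ ^ 2)) ?_ hs
  refine Continuous.div (by fun_prop) (by fun_prop) ?_
  rintro ⟨k, θ⟩
  exact (Real.sqrt_pos.2 (one_sub_sq_mul_sin_sq_pos (hA k k.2) θ)).ne'

theorem ellK_pos {k : ℝ} (hk : k ^ 2 < 1) : 0 < ellK k := by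
  rw [ellK_eq_ellF]
  exact lt_of_lt_of_le (by positivity) (le_ellF hk (by positivity))

theorem one_le_ellK {k : ℝ} (hk : k ^ 2 < 1) : 1 ≤ ellK k := by
  rw [ellK_eq_ellF]
  have := le_ellF hk (θ := Real.pi / 2) (by positivity)
  linarith [Real.pi_gt_three]

/-- This makes K blow up as k tends to 1. With c the complementary modulus, 1 - k² sin² x = cos² x +
c² sin² x ≤ (cos x + c)² and cos x ≤ π/2 - x, so the integrand dominates 1/(π/2 - x + c), whose
primitive is a logarithm. -/
theorem neg_log_le_ellK {k c : ℝ} (hc : 0 < c) (h : k ^ 2 + c ^ 2 = 1) :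
    -Real.log c ≤ ellK k := by
  have hk : k ^ 2 < 1 := by nlinarith
  have hpi := Real.pi_gt_three
  have hder : ∀ x ∈ uIcc 0 (Real.pi / 2), HasDerivAt (fun x => -Real.log (Real.pi / 2 - x + c))
      (1 / (Real.pi / 2 - x + c)) x := fun x hx => by
    rw [uIcc_of_le (by positivity)] at hx
    have hne : Real.pi / 2 - x + c ≠ 0 := by linarith [hx.2]
    refine ((((hasDerivAt_id x).const_sub _).add_const c).log hne).neg.congr_deriv ?_
    simp [neg_div]
  have hint : IntervalIntegrable (fun x => 1 / (Real.pi / 2 - x + c)) volume 0 (Real.pi / 2) := by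
    refine ContinuousOn.intervalIntegrable (ContinuousOn.div (by fun_prop) (by fun_prop) ?_)
    intro x hx
    rw [uIcc_of_le (by positivity)] at hx
    linarith [hx.2]
  have hval := intervalIntegral.integral_eq_sub_of_hasDerivAt hder hint
  have hmono := intervalIntegral.integral_mono_on (by positivity) hint
    ((continuous_ellF_integrand hk).intervalIntegrable 0 (Real.pi / 2)) fun x hx => by
      refine one_div_le_one_div_of_le (Real.sqrt_pos.2 (one_sub_sq_mul_sin_sq_pos hk x)) ?_
      have hcos0 : 0 ≤ Real.cos x := Real.cos_nonneg_of_mem_Icc ⟨by linarith [hx.1], hx.2⟩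
      have hcos : Real.cos x ≤ Real.pi / 2 - x := by
        rw [← Real.sin_pi_div_two_sub]
        exact Real.sin_le (by linarith [hx.2])
      refine Real.sqrt_le_iff.2 ⟨by linarith, ?_⟩
      have h1 : 1 - k ^ 2 * Real.sin x ^ 2 ≤ (Real.cos x + c) ^ 2 := by
        have := Real.sin_sq_add_cos_sq x
        nlinarith [mul_nonneg hcos0 hc.le, mul_nonneg (sq_nonneg c) (sq_nonneg (Real.cos x))]
      exact h1.trans (pow_le_pow_left₀ (by linarith) (by linarith) 2)
  rw [ellK_eq_ellF, ellF]
  refine le_trans ?_ hmono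
  rw [hval]
  have : 0 ≤ Real.log (Real.pi / 2 - 0 + c) := Real.log_nonneg (by linarith)
  have h2 : Real.pi / 2 - Real.pi / 2 + c = c := by ring
  rw [h2]
  linarith

theorem S_strictMonoOn : StrictMonoOn S modulusRange := by
  intro a ha b hb hab
  have ha0 := modulusRange_pos ha
  have hK : ellK a ≤ ellK b := by
    rw [ellK_eq_ellF, ellK_eq_ellF]
    exact ellF_le_ellF_of_modulus_le ha0.le hab.le (modulusRange_sq_lt hb) (by positivity)
  have hsq : a ^ 2 < b ^ 2 := pow_lt_pow_left₀ hab ha0.le two_ne_zero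
  have hroot : √(2 * a ^ 2 - 1) < √(2 * b ^ 2 - 1) :=
    Real.sqrt_lt_sqrt (by linarith [half_lt_modulusRange_sq ha]) (by linarith)
  have hKa := ellK_pos (modulusRange_sq_lt ha)
  have := Real.sqrt_nonneg (2 * a ^ 2 - 1)
  simp only [S]
  nlinarith

theorem S_pos {k : ℝ} (hk : k ∈ modulusRange) : 0 < S k := by
  have := ellK_pos (modulusRange_sq_lt hk)
  have : 0 < √(2 * k ^ 2 - 1) := Real.sqrt_pos.2 (by linarith [half_lt_modulusRange_sq hk])
  unfold S
  positivity

theorem one_div_sqrt_two_pos : (0 : ℝ) < 1 / √2 := by positivity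

theorem sq_lt_one_of_mem_Ico {k : ℝ} (hk : k ∈ Ico (1 / √2) 1) : k ^ 2 < 1 := by
  nlinarith [hk.2, one_div_sqrt_two_pos.trans_le hk.1]

theorem continuousOn_ellK : ContinuousOn ellK (Ico (1 / √2) 1) := by
  refine (continuousOn_ellF_modulus (s := fun _ => Real.pi / 2)
    (fun k hk => sq_lt_one_of_mem_Ico hk) continuousOn_const).congr fun k _ => ellK_eq_ellF

theorem exists_S_eq {y : ℝ} (hy : 0 < y) : ∃ k ∈ modulusRange, S k = y := by
  -- This c gives K ≥ y/2 + 1, while c < 1/2 gives √(2k² - 1) ≥ 1/2; together S(k) ≥ y + 2. The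
  -- intermediate value theorem then applies from 1/√2, where S vanishes.
  set c := Real.exp (-(y / 2 + 1)) with hc
  have hc0 : 0 < c := Real.exp_pos _
  have hc1 : c < 1 / 2 := by
    have h1 : c ≤ Real.exp (-1) := Real.exp_le_exp.2 (by linarith)
    have h2 : Real.exp (-1) < 1 / 2 := by
      rw [Real.exp_neg, inv_eq_one_div]
      exact one_div_lt_one_div_of_lt two_pos (by linarith [Real.exp_one_gt_d9])
    linarith
  set k := √(1 - c ^ 2) with hkdef
  have hksq : k ^ 2 = 1 - c ^ 2 := Real.sq_sqrt (by nlinarith)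
  have hk : k ∈ modulusRange :=
    mem_modulusRange (Real.sqrt_pos.2 (by nlinarith)) (by nlinarith) (by nlinarith)
  have hlog := neg_log_le_ellK (k := k) hc0 (by linarith)
  rw [hc, Real.log_exp] at hlog
  have hroot : 1 / 2 ≤ √(2 * k ^ 2 - 1) := Real.le_sqrt_of_sq_le (by nlinarith)
  have hle : y ≤ S k := by
    simp only [S]
    nlinarith
  have hzero : S (1 / √2) = 0 := by
    rw [S, one_div_sqrt_two_sq]; norm_num
  have hcont : ContinuousOn S (Icc (1 / √2) k) := by
    refine ContinuousOn.mul (by fun_prop) (continuousOn_ellK.mono fun x hx =>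
      ⟨hx.1, hx.2.trans_lt hk.2⟩)
  obtain ⟨x, hx, hxy⟩ := intermediate_value_Icc hk.1.le hcont ⟨hzero.trans_le hy.le, hle⟩
  refine ⟨x, ⟨lt_of_le_of_ne hx.1 ?_, hx.2.trans_lt hk.2⟩, hxy⟩
  rintro rfl
  linarith

theorem SInv_mem {y : ℝ} (hy : 0 < y) : SInv y ∈ modulusRange :=
  Function.invFunOn_mem (exists_S_eq hy)

theorem S_SInv {y : ℝ} (hy : 0 < y) : S (SInv y) = y :=
  Function.invFunOn_eq (exists_S_eq hy)

theorem SInv_S {k : ℝ} (hk : k ∈ modulusRange) : SInv (S k) = k :=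
  S_strictMonoOn.injOn (SInv_mem (S_pos hk)) hk (S_SInv (S_pos hk))

theorem shiftIntegral_eq_ellF {k : ℝ} (hk : k ∈ Ico (1 / √2) 1) :
    shiftIntegral k = ellF k (Real.arccos √((2 * k ^ 2 - 1) / k ^ 2)) := by
  have h0 : 0 < k := one_div_sqrt_two_pos.trans_le hk.1
  refine integral_eq_ellF_arccos (Real.sqrt_nonneg _) (Real.sqrt_le_one.2 ?_)
  rw [div_le_one (by positivity)]
  linarith [sq_lt_one_of_mem_Ico hk]

/-- In the form `ellF k (arccos ..)` the integrand grows with k while the upper limit shrinks, so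
monotonicity is hidden. Putting sin θ = ct with c² = (1 - k²)/k² fixes the limits, and then both the
prefactor and the integrand decrease in k. -/
theorem shiftIntegral_eq_integral {k : ℝ} (hk : k ∈ modulusRange) :
    shiftIntegral k = √((1 - k ^ 2) / k ^ 2) * ∫ t in (0 : ℝ)..1,
      1 / (√(1 - (1 - k ^ 2) / k ^ 2 * t ^ 2) * √(1 - (1 - k ^ 2) * t ^ 2)) := by
  have h0 := modulusRange_pos hk
  have h1 := modulusRange_sq_lt hk
  have h2 := half_lt_modulusRange_sq hk
  set c := √((1 - k ^ 2) / k ^ 2) with hc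
  have hcsq : c ^ 2 = (1 - k ^ 2) / k ^ 2 :=
    Real.sq_sqrt (div_nonneg (by linarith) (by positivity))
  have hkc : k ^ 2 * c ^ 2 = 1 - k ^ 2 := by rw [hcsq]; field_simp
  have hc0 : 0 ≤ c := Real.sqrt_nonneg _
  have hc1 : c < 1 := by
    refine lt_of_pow_lt_pow_left₀ 2 zero_le_one ?_
    rw [hcsq, one_pow, div_lt_one (by positivity)]
    linarith
  have harc : Real.arccos √((2 * k ^ 2 - 1) / k ^ 2) = Real.arcsin c := by
    rw [Real.arccos_eq_arcsin (Real.sqrt_nonneg _),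
      Real.sq_sqrt (div_nonneg (by linarith) (by positivity)), hc]
    congr 2
    field_simp
    ring
  have hct : ∀ t ∈ uIcc (0 : ℝ) 1, 0 ≤ c * t ∧ c * t < 1 := fun t ht => by
    rw [uIcc_of_le zero_le_one] at ht
    exact ⟨mul_nonneg hc0 ht.1, by nlinarith [ht.1, ht.2]⟩
  have hden : ∀ t ∈ uIcc (0 : ℝ) 1,
      0 < 1 - (1 - k ^ 2) / k ^ 2 * t ^ 2 ∧ 0 < 1 - (1 - k ^ 2) * t ^ 2 := fun t ht => by
    obtain ⟨ha, hb⟩ := hct t ht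
    rw [← hcsq, ← hkc]
    have h3 : (c * t) ^ 2 < 1 := by nlinarith
    constructor <;> nlinarith [sq_nonneg (c * t)]
  have hder : ∀ t ∈ uIcc (0 : ℝ) 1, HasDerivAt (fun t => ellF k (Real.arcsin (c * t)))
      (c * (1 / (√(1 - (1 - k ^ 2) / k ^ 2 * t ^ 2) * √(1 - (1 - k ^ 2) * t ^ 2)))) t := by
    intro t ht
    obtain ⟨ha, hb⟩ := hct t ht
    have hasin := (Real.hasDerivAt_arcsin (by linarith : c * t ≠ -1) hb.ne).comp t
      ((hasDerivAt_id t).const_mul c)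
    have := (hasDerivAt_ellF h1 (Real.arcsin (c * t))).comp t hasin
    refine this.congr_deriv ?_
    rw [Real.sin_arcsin (by linarith) hb.le]
    have e1 : 1 - (c * t) ^ 2 = 1 - (1 - k ^ 2) / k ^ 2 * t ^ 2 := by rw [← hcsq]; ring
    have e2 : 1 - k ^ 2 * (c * t) ^ 2 = 1 - (1 - k ^ 2) * t ^ 2 := by rw [← hkc]; ring
    rw [e1, e2]
    have p1 := (Real.sqrt_pos.2 (hden t ht).1).ne'
    have p2 := (Real.sqrt_pos.2 (hden t ht).2).ne'
    field_simp
  have hint := intervalIntegral.integral_eq_sub_of_hasDerivAt hder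
    (ContinuousOn.intervalIntegrable (continuousOn_const.mul (ContinuousOn.div (by fun_prop)
      (by fun_prop) fun t ht => (mul_pos (Real.sqrt_pos.2 (hden t ht).1)
        (Real.sqrt_pos.2 (hden t ht).2)).ne')))
  rw [intervalIntegral.integral_const_mul] at hint
  rw [hint, shiftIntegral_eq_ellF ⟨hk.1.le, hk.2⟩, harc]
  simp

theorem shift_density_bounds {a t : ℝ} (ha : a ∈ modulusRange) (ht : t ∈ Icc (0 : ℝ) 1) :
    0 < 1 - (1 - a ^ 2) / a ^ 2 * t ^ 2 ∧ 0 < 1 - (1 - a ^ 2) * t ^ 2 := by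
  have h1 := modulusRange_sq_lt ha
  have h2 := half_lt_modulusRange_sq ha
  have h3 : (1 - a ^ 2) / a ^ 2 < 1 := by rw [div_lt_one (by linarith)]; linarith
  have h4 : 0 ≤ (1 - a ^ 2) / a ^ 2 := div_nonneg (by linarith) (by linarith)
  have h5 : t ^ 2 ≤ 1 := by nlinarith [ht.1, ht.2]
  constructor <;> nlinarith [sq_nonneg t]

theorem intervalIntegrable_shift_density {a : ℝ} (ha : a ∈ modulusRange) :
    IntervalIntegrable (fun t => 1 / (√(1 - (1 - a ^ 2) / a ^ 2 * t ^ 2) *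
      √(1 - (1 - a ^ 2) * t ^ 2))) volume 0 1 :=
  ContinuousOn.intervalIntegrable (ContinuousOn.div (by fun_prop) (by fun_prop) fun t ht => by
    rw [uIcc_of_le zero_le_one] at ht
    exact (mul_pos (Real.sqrt_pos.2 (shift_density_bounds ha ht).1)
        (Real.sqrt_pos.2 (shift_density_bounds ha ht).2)).ne')

theorem integral_shift_density_antitone {a b : ℝ} (ha : a ∈ modulusRange)
    (hb : b ∈ modulusRange) (hab : a ≤ b) :
    ∫ t in (0 : ℝ)..1, 1 / (√(1 - (1 - b ^ 2) / b ^ 2 * t ^ 2) * √(1 - (1 - b ^ 2) * t ^ 2)) ≤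
    ∫ t in (0 : ℝ)..1, 1 / (√(1 - (1 - a ^ 2) / a ^ 2 * t ^ 2) * √(1 - (1 - a ^ 2) * t ^ 2)) := by
  have hsq : a ^ 2 ≤ b ^ 2 := pow_le_pow_left₀ (modulusRange_pos ha).le hab 2
  have ha2 := half_lt_modulusRange_sq ha
  refine intervalIntegral.integral_mono_on zero_le_one (intervalIntegrable_shift_density hb)
    (intervalIntegrable_shift_density ha) fun t ht => ?_
  have hq : (1 - b ^ 2) / b ^ 2 ≤ (1 - a ^ 2) / a ^ 2 := by
    rw [div_le_div_iff₀ (by linarith) (by linarith)]; nlinarith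
  have hA := shift_density_bounds ha ht
  refine one_div_le_one_div_of_le (mul_pos (Real.sqrt_pos.2 hA.1) (Real.sqrt_pos.2 hA.2)) ?_
  exact mul_le_mul (Real.sqrt_le_sqrt (by nlinarith [sq_nonneg t]))
    (Real.sqrt_le_sqrt (by nlinarith [sq_nonneg t])) (Real.sqrt_nonneg _) (Real.sqrt_nonneg _)

theorem integral_shift_density_pos {a : ℝ} (ha : a ∈ modulusRange) :
    0 < ∫ t in (0 : ℝ)..1,
      1 / (√(1 - (1 - a ^ 2) / a ^ 2 * t ^ 2) * √(1 - (1 - a ^ 2) * t ^ 2)) := by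
  refine intervalIntegral.intervalIntegral_pos_of_pos_on (intervalIntegrable_shift_density ha)
    (fun t ht => ?_) zero_lt_one
  have := shift_density_bounds ha (Ioo_subset_Icc_self ht)
  exact one_div_pos.2 (mul_pos (Real.sqrt_pos.2 this.1) (Real.sqrt_pos.2 this.2))

theorem shiftIntegral_pos {k : ℝ} (hk : k ∈ modulusRange) : 0 < shiftIntegral k := by
  rw [shiftIntegral_eq_integral hk]
  refine mul_pos (Real.sqrt_pos.2 (div_pos ?_ (pow_pos (modulusRange_pos hk) 2)))
    (integral_shift_density_pos hk)
  linarith [modulusRange_sq_lt hk]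

theorem shiftIntegral_lt_ellK {k : ℝ} (hk : k ∈ modulusRange) : shiftIntegral k < ellK k := by
  rw [shiftIntegral_eq_ellF ⟨hk.1.le, hk.2⟩, ellK_eq_ellF]
  refine ellF_strictMono (modulusRange_sq_lt hk) (Real.arccos_lt_pi_div_two.2
    (Real.sqrt_pos.2 (div_pos ?_ (pow_pos (modulusRange_pos hk) 2))))
  linarith [half_lt_modulusRange_sq hk]

theorem phi_pos {k : ℝ} (hk : k ∈ modulusRange) : 0 < phi k :=
  div_pos (shiftIntegral_pos hk) (ellK_pos (modulusRange_sq_lt hk))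

theorem phi_lt_one {k : ℝ} (hk : k ∈ modulusRange) : phi k < 1 :=
  (div_lt_one (ellK_pos (modulusRange_sq_lt hk))).2 (shiftIntegral_lt_ellK hk)

theorem phi_strictAntiOn : StrictAntiOn phi modulusRange := by
  intro a ha b hb hab
  have ha0 := modulusRange_pos ha
  have hsq : a ^ 2 < b ^ 2 := pow_lt_pow_left₀ hab ha0.le two_ne_zero
  have hK : ellK a ≤ ellK b := by
    rw [ellK_eq_ellF, ellK_eq_ellF]
    exact ellF_le_ellF_of_modulus_le ha0.le hab.le (modulusRange_sq_lt hb) (by positivity)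
  have hH : shiftIntegral b < shiftIntegral a := by
    rw [shiftIntegral_eq_integral ha, shiftIntegral_eq_integral hb]
    refine mul_lt_mul (Real.sqrt_lt_sqrt ?_ ?_) (integral_shift_density_antitone ha hb hab.le)
      (integral_shift_density_pos hb) (Real.sqrt_nonneg _)
    · exact div_nonneg (by linarith [modulusRange_sq_lt hb]) (sq_nonneg _)
    · rw [div_lt_div_iff₀ (pow_pos (ha0.trans hab) 2) (pow_pos ha0 2)]
      linarith
  exact div_lt_div₀ hH hK (shiftIntegral_pos ha).le (ellK_pos (modulusRange_sq_lt ha))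

theorem exists_phi_le {y : ℝ} (hy : 0 < y) : ∃ k ∈ modulusRange, phi k ≤ y := by
  have h9 : (9 / 10 : ℝ) ∈ modulusRange :=
    mem_modulusRange (by norm_num) (by norm_num) (by norm_num)
  set C := ∫ t in (0 : ℝ)..1, 1 / (√(1 - (1 - (9 / 10 : ℝ) ^ 2) / (9 / 10) ^ 2 * t ^ 2) *
    √(1 - (1 - (9 / 10 : ℝ) ^ 2) * t ^ 2)) with hC
  have hC0 : 0 < C := integral_shift_density_pos h9
  -- The modulus below is chosen so that the prefactor √((1 - k²)/k²) equals δ. The bound 1/10 keeps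
  -- k ≥ 9/10, so the remaining integral is at most C; the bound y/C then gives H ≤ y, and K ≥ 1.
  set δ := min (y / C) (1 / 10) with hδ
  have hδ0 : 0 < δ := lt_min (div_pos hy hC0) (by norm_num)
  have hδ1 : δ ≤ 1 / 10 := min_le_right _ _
  set k := √(1 / (1 + δ ^ 2)) with hk
  have hksq : k ^ 2 = 1 / (1 + δ ^ 2) := Real.sq_sqrt (by positivity)
  have hk0 : 0 < k := Real.sqrt_pos.2 (by positivity)
  have hlow : 100 / 101 ≤ k ^ 2 := by
    rw [hksq, div_le_div_iff₀ (by norm_num) (by positivity)]; nlinarith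
  have hk1 : k ^ 2 < 1 := by
    rw [hksq, div_lt_one (by positivity)]; nlinarith
  have hmem : k ∈ modulusRange := mem_modulusRange hk0 (by linarith) hk1
  refine ⟨k, hmem, ?_⟩
  have hle : (9 / 10 : ℝ) ≤ k := by nlinarith
  have hcoef : √((1 - k ^ 2) / k ^ 2) = δ := by
    have : (1 - k ^ 2) / k ^ 2 = δ ^ 2 := by
      rw [hksq]; field_simp; ring
    rw [this, Real.sqrt_sq hδ0.le]
  have hH : shiftIntegral k ≤ y := by
    rw [shiftIntegral_eq_integral hmem, hcoef]
    calc _ ≤ y / C * C := mul_le_mul (min_le_left _ _)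
            (integral_shift_density_antitone h9 hmem hle) (integral_shift_density_pos hmem).le
            (by positivity)
      _ = y := by field_simp
  rw [phi, div_le_iff₀ (ellK_pos hk1)]
  nlinarith [one_le_ellK hk1]

theorem exists_phi_eq {y : ℝ} (hy0 : 0 < y) (hy1 : y < 1) : ∃ k ∈ modulusRange, phi k = y := by
  obtain ⟨k, hk, hle⟩ := exists_phi_le hy0
  have hmem : (1 / √2 : ℝ) ∈ Ico (1 / √2 : ℝ) 1 := ⟨le_rfl, hk.1.trans hk.2⟩
  -- At the excluded endpoint the lower limit of the shift integral is 0, so H and K coincide there;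
  -- this is the upper end for the intermediate value theorem.
  have hone : phi (1 / √2) = 1 := by
    rw [phi, shiftIntegral_eq_ellF hmem, one_div_sqrt_two_sq, ellK_eq_ellF]
    have hF : ellF (1 / √2) (Real.pi / 2) ≠ 0 :=
      ellK_eq_ellF ▸ (ellK_pos (sq_lt_one_of_mem_Ico hmem)).ne'
    norm_num at hF ⊢
    exact hF
  have hcont : ContinuousOn phi (Icc (1 / √2) k) := by
    have hsub : Icc (1 / √2) k ⊆ Ico (1 / √2) 1 := fun x hx => ⟨hx.1, hx.2.trans_lt hk.2⟩
    refine ContinuousOn.div ?_ (continuousOn_ellK.mono hsub)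
      fun x hx => (ellK_pos (sq_lt_one_of_mem_Ico (hsub hx))).ne'
    refine ContinuousOn.congr (continuousOn_ellF_modulus
      (s := fun k => Real.arccos √((2 * k ^ 2 - 1) / k ^ 2))
      (fun x hx => sq_lt_one_of_mem_Ico (hsub hx)) ?_)
      fun x hx => shiftIntegral_eq_ellF (hsub hx)
    refine Real.continuous_arccos.comp_continuousOn (ContinuousOn.sqrt
      (ContinuousOn.div (by fun_prop) (by fun_prop) fun x hx => ?_))
    exact (pow_pos (one_div_sqrt_two_pos.trans_le hx.1) 2).ne'
  obtain ⟨x, hx, hxy⟩ := intermediate_value_Icc' hk.1.le hcont ⟨hle, hy1.le.trans hone.ge⟩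
  refine ⟨x, ⟨lt_of_le_of_ne hx.1 ?_, hx.2.trans_lt hk.2⟩, hxy⟩
  rintro rfl
  linarith

theorem phiInv_mem {y : ℝ} (hy0 : 0 < y) (hy1 : y < 1) : phiInv y ∈ modulusRange :=
  Function.invFunOn_mem (exists_phi_eq hy0 hy1)

theorem phi_phiInv {y : ℝ} (hy0 : 0 < y) (hy1 : y < 1) : phi (phiInv y) = y :=
  Function.invFunOn_eq (exists_phi_eq hy0 hy1)

theorem phiInv_phi {k : ℝ} (hk : k ∈ modulusRange) : phiInv (phi k) = k :=
  phi_strictAntiOn.injOn (phiInv_mem (phi_pos hk) (phi_lt_one hk)) hk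
    (phi_phiInv (phi_pos hk) (phi_lt_one hk))

/-! ### The cnoidal profile of given modulus and frequency -/

noncomputable section Profile

/-- The cnoidal wave of modulus `k` and frequency `ω`. -/
def profile (k ω x : ℝ) : ℝ :=
  √(2 * |ω| * k ^ 2 / (2 * k ^ 2 - 1)) * jacobiCn (√(|ω| / (2 * k ^ 2 - 1)) * x) k

/-- The derivative of `profile`. -/
def profileDeriv (k ω x : ℝ) : ℝ :=
  √(2 * |ω| * k ^ 2 / (2 * k ^ 2 - 1)) *
    (√(|ω| / (2 * k ^ 2 - 1)) * jacobiCnDeriv (√(|ω| / (2 * k ^ 2 - 1)) * x) k)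

/-- The position at which the profile of modulus `k` takes the value `√(2|ω|)`. -/
def profileShift (k ω : ℝ) : ℝ := √((2 * k ^ 2 - 1) / |ω|) * shiftIntegral k

/-- The period of `profile`. -/
def profilePeriod (k ω : ℝ) : ℝ := S k / √|ω|

variable {k ω : ℝ}

theorem profile_freq_pos (hk : k ∈ modulusRange) (hω : ω < 0) : 0 < √(|ω| / (2 * k ^ 2 - 1)) :=
  Real.sqrt_pos.2 (div_pos (abs_pos.2 hω.ne) (by linarith [half_lt_modulusRange_sq hk]))

theorem profile_amp_pos (hk : k ∈ modulusRange) (hω : ω < 0) :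
    0 < √(2 * |ω| * k ^ 2 / (2 * k ^ 2 - 1)) :=
  Real.sqrt_pos.2 (div_pos (mul_pos (mul_pos two_pos (abs_pos.2 hω.ne))
    (pow_pos (modulusRange_pos hk) 2)) (by linarith [half_lt_modulusRange_sq hk]))

theorem profile_freq_sq (hk : k ∈ modulusRange) :
    √(|ω| / (2 * k ^ 2 - 1)) ^ 2 = |ω| / (2 * k ^ 2 - 1) :=
  Real.sq_sqrt (div_nonneg (abs_nonneg _) (by linarith [half_lt_modulusRange_sq hk]))

theorem profile_amp_sq (hk : k ∈ modulusRange) :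
    √(2 * |ω| * k ^ 2 / (2 * k ^ 2 - 1)) ^ 2 = 2 * |ω| * k ^ 2 / (2 * k ^ 2 - 1) :=
  Real.sq_sqrt (div_nonneg (by positivity) (by linarith [half_lt_modulusRange_sq hk]))

theorem hasDerivAt_profile (hk : k ∈ modulusRange) (x : ℝ) :
    HasDerivAt (profile k ω) (profileDeriv k ω x) x := by
  have h := ((hasDerivAt_jacobiCn (modulusRange_sq_lt hk) (√(|ω| / (2 * k ^ 2 - 1)) * x)).comp x
    ((hasDerivAt_id x).const_mul _)).const_mul √(2 * |ω| * k ^ 2 / (2 * k ^ 2 - 1))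
  refine h.congr_deriv ?_
  simp only [profileDeriv]
  ring

theorem hasDerivAt_profileDeriv (hk : k ∈ modulusRange) (hω : ω < 0) (x : ℝ) :
    HasDerivAt (profileDeriv k ω) (-(ω * profile k ω x) - profile k ω x ^ 3) x := by
  have h := (((hasDerivAt_jacobiCnDeriv (modulusRange_sq_lt hk)
    (√(|ω| / (2 * k ^ 2 - 1)) * x)).comp x ((hasDerivAt_id x).const_mul _)).const_mul
      √(|ω| / (2 * k ^ 2 - 1))).const_mul √(2 * |ω| * k ^ 2 / (2 * k ^ 2 - 1))
  refine h.congr_deriv ?_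
  have hf := profile_freq_sq (ω := ω) hk
  have ha := profile_amp_sq (ω := ω) hk
  have hpos : 2 * k ^ 2 - 1 ≠ 0 := by linarith [half_lt_modulusRange_sq hk]
  simp only [profile]
  generalize jacobiCn (√(|ω| / (2 * k ^ 2 - 1)) * x) k = c at *
  generalize √(|ω| / (2 * k ^ 2 - 1)) = b at *
  generalize √(2 * |ω| * k ^ 2 / (2 * k ^ 2 - 1)) = a at *
  rw [abs_of_neg hω] at *
  rw [eq_div_iff hpos] at hf ha
  -- This relation between amplitude and frequency normalises the cubic coefficient to 1.
  have hab : a ^ 2 = 2 * k ^ 2 * b ^ 2 := by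
    apply mul_right_cancel₀ hpos
    linear_combination ha - 2 * k ^ 2 * hf
  linear_combination (a * c) * hf + (a * c ^ 3) * hab

theorem profilePeriod_eq (hk : k ∈ modulusRange) (hω : ω < 0) :
    √(|ω| / (2 * k ^ 2 - 1)) * profilePeriod k ω = 4 * ellF k (Real.pi / 2) := by
  have h1 : 0 < √|ω| := Real.sqrt_pos.2 (abs_pos.2 hω.ne)
  have h2 : 0 < √(2 * k ^ 2 - 1) := Real.sqrt_pos.2 (by linarith [half_lt_modulusRange_sq hk])
  rw [Real.sqrt_div (abs_nonneg _), profilePeriod, S, ellK_eq_ellF]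
  field_simp

theorem profilePeriod_pos (hk : k ∈ modulusRange) (hω : ω < 0) : 0 < profilePeriod k ω :=
  div_pos (S_pos hk) (Real.sqrt_pos.2 (abs_pos.2 hω.ne))

theorem freq_mul_profileShift (hk : k ∈ modulusRange) (hω : ω < 0) :
    √(|ω| / (2 * k ^ 2 - 1)) * profileShift k ω = shiftIntegral k := by
  have h1 : 0 < √|ω| := Real.sqrt_pos.2 (abs_pos.2 hω.ne)
  have h2 : 0 < √(2 * k ^ 2 - 1) := Real.sqrt_pos.2 (by linarith [half_lt_modulusRange_sq hk])
  rw [profileShift, Real.sqrt_div (abs_nonneg _),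
    Real.sqrt_div (by linarith [half_lt_modulusRange_sq hk])]
  field_simp

/-- The meaning of φ: the shift measured in quarter periods. -/
theorem profileShift_eq (hk : k ∈ modulusRange) (hω : ω < 0) :
    profileShift k ω = phi k * profilePeriod k ω / 4 := by
  have hb := profile_freq_pos hk hω
  have hK := (ellK_pos (modulusRange_sq_lt hk)).ne'
  have h1 := profilePeriod_eq hk hω
  have h2 := freq_mul_profileShift hk hω
  apply mul_left_cancel₀ hb.ne'
  rw [h2, mul_div_assoc', mul_left_comm, h1, phi, ← ellK_eq_ellF]
  field_simp

theorem profile_neg (hk : k ∈ modulusRange) (x : ℝ) : profile k ω (-x) = profile k ω x := by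
  simp only [profile, mul_neg, jacobiCn_neg (modulusRange_sq_lt hk)]

theorem profileDeriv_neg (hk : k ∈ modulusRange) (x : ℝ) :
    profileDeriv k ω (-x) = -profileDeriv k ω x := by
  simp only [profileDeriv, mul_neg, jacobiCnDeriv_neg (modulusRange_sq_lt hk)]

theorem freq_mul_add_half_period (hk : k ∈ modulusRange) (hω : ω < 0) (x : ℝ) :
    √(|ω| / (2 * k ^ 2 - 1)) * (x + profilePeriod k ω / 2) =
      √(|ω| / (2 * k ^ 2 - 1)) * x + 2 * ellF k (Real.pi / 2) := by
  linear_combination (1 / 2) * profilePeriod_eq hk hω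

theorem profile_antiperiodic (hk : k ∈ modulusRange) (hω : ω < 0) :
    Function.Antiperiodic (profile k ω) (profilePeriod k ω / 2) := fun x => by
  have := jacobiCn_antiperiodic (modulusRange_sq_lt hk) (√(|ω| / (2 * k ^ 2 - 1)) * x)
  simp only [profile, freq_mul_add_half_period hk hω]
  simp only at this
  rw [this, mul_neg]

theorem profileDeriv_antiperiodic (hk : k ∈ modulusRange) (hω : ω < 0) :
    Function.Antiperiodic (profileDeriv k ω) (profilePeriod k ω / 2) := fun x => by
  have := jacobiCnDeriv_antiperiodic (modulusRange_sq_lt hk) (√(|ω| / (2 * k ^ 2 - 1)) * x)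
  simp only [profileDeriv, freq_mul_add_half_period hk hω]
  simp only at this
  rw [this, mul_neg, mul_neg]

theorem profile_eq_iff (hk : k ∈ modulusRange) (hω : ω < 0) {y z : ℝ} :
    profile k ω y = profile k ω z ↔
      ∃ m : ℤ, z = y + m * profilePeriod k ω ∨ z = -y + m * profilePeriod k ω := by
  have hb := (profile_freq_pos hk hω).ne'
  have hT := profilePeriod_eq hk hω
  rw [profile, profile, mul_right_inj' (profile_amp_pos hk hω).ne',
    jacobiCn_eq_iff (modulusRange_sq_lt hk), ← hT]
  refine exists_congr fun m => or_congr ?_ ?_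
  · rw [← mul_right_inj' hb (b := z)]
    ring_nf
  · rw [← mul_right_inj' hb (b := z)]
    ring_nf

theorem eq_add_period_of_profile_eq (hk : k ∈ modulusRange) (hω : ω < 0) {y z : ℝ}
    (h : profile k ω y = profile k ω z) (h' : profileDeriv k ω y = profileDeriv k ω z) :
    ∃ m : ℤ, z = y + m * profilePeriod k ω := by
  have hb := (profile_freq_pos hk hω).ne'
  have ha := (profile_amp_pos hk hω).ne'
  obtain ⟨m, hm⟩ := eq_add_period_of_jacobiCn_eq (modulusRange_sq_lt hk)
    (mul_left_cancel₀ ha h) (mul_left_cancel₀ hb (mul_left_cancel₀ ha h'))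
  refine ⟨m, mul_left_cancel₀ hb ?_⟩
  rw [hm, ← profilePeriod_eq hk hω]
  ring

theorem jacobiCn_shiftIntegral (hk : k ∈ modulusRange) :
    jacobiCn (shiftIntegral k) k = √((2 * k ^ 2 - 1) / k ^ 2) := by
  rw [jacobiCn, shiftIntegral_eq_ellF ⟨hk.1.le, hk.2⟩, jacobiAm_ellF (modulusRange_sq_lt hk)]
  refine Real.cos_arccos (by linarith [Real.sqrt_nonneg ((2 * k ^ 2 - 1) / k ^ 2)])
    (Real.sqrt_le_one.2 ?_)
  rw [div_le_one (pow_pos (modulusRange_pos hk) 2)]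
  linarith [modulusRange_sq_lt hk]

theorem profile_profileShift (hk : k ∈ modulusRange) (hω : ω < 0) :
    profile k ω (profileShift k ω) = √(2 * |ω|) := by
  have h1 : 0 < 2 * k ^ 2 - 1 := by linarith [half_lt_modulusRange_sq hk]
  have h2 := modulusRange_pos hk
  rw [profile, freq_mul_profileShift hk hω, jacobiCn_shiftIntegral hk, ← Real.sqrt_mul]
  · congr 1
    field_simp
  · positivity

theorem profileDeriv_profileShift_sq (hk : k ∈ modulusRange) (hω : ω < 0) :
    profileDeriv k ω (profileShift k ω) ^ 2 =
      2 * ω ^ 2 * k ^ 2 * (1 - k ^ 2) / (2 * k ^ 2 - 1) ^ 2 := by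
  have h1 : 0 < 2 * k ^ 2 - 1 := by linarith [half_lt_modulusRange_sq hk]
  have h2 := modulusRange_pos hk
  rw [profileDeriv, freq_mul_profileShift hk hω, mul_pow, mul_pow, profile_freq_sq hk,
    profile_amp_sq hk, jacobiCnDeriv_sq (modulusRange_sq_lt hk), jacobiCn_shiftIntegral hk,
    Real.sq_sqrt (by positivity), ← sq_abs ω]
  field_simp
  ring

/-- Every positive value of the squared slope at height `√(2|ω|)` belongs to some modulus. -/
theorem exists_modulus_slope_sq (hω : ω < 0) {v : ℝ} (hv : v ≠ 0) :
    ∃ k ∈ modulusRange, profileDeriv k ω (profileShift k ω) ^ 2 = v ^ 2 := by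
  have hω0 : ω ≠ 0 := hω.ne
  set e := v ^ 2 / ω ^ 2 with he
  have he0 : 0 < e := by positivity
  -- With d = 2k² - 1 the squared slope is ω²(1 - d²)/(2d²); equating it to v² and solving for d²
  -- gives this value.
  set d := √(1 / (1 + 2 * e)) with hd
  have hdsq : d ^ 2 = 1 / (1 + 2 * e) := Real.sq_sqrt (by positivity)
  have hd0 : 0 < d := Real.sqrt_pos.2 (by positivity)
  have hd1 : d < 1 := by
    refine lt_of_pow_lt_pow_left₀ 2 zero_le_one ?_
    rw [hdsq, one_pow, div_lt_one (by positivity)]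
    linarith
  have hksq : √((1 + d) / 2) ^ 2 = (1 + d) / 2 := Real.sq_sqrt (by positivity)
  have hk : √((1 + d) / 2) ∈ modulusRange :=
    mem_modulusRange (Real.sqrt_pos.2 (by positivity)) (by linarith) (by linarith)
  refine ⟨_, hk, ?_⟩
  rw [profileDeriv_profileShift_sq hk hω, hksq]
  have h1 : 2 * ω ^ 2 * ((1 + d) / 2) * (1 - (1 + d) / 2) = ω ^ 2 * (1 - d ^ 2) / 2 := by ring
  have h2 : (2 * ((1 + d) / 2) - 1) ^ 2 = d ^ 2 := by ring
  rw [h1, h2, hdsq, he]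
  field_simp
  ring

end Profile

/-! ### The modulus determined by a period -/

theorem mul_sqrt_div_pos {L ω : ℝ} {n : ℕ} (hL : 0 < L) (hn : 1 ≤ n) (hω : ω < 0) :
    0 < L * √|ω| / n :=
  div_pos (mul_pos hL (Real.sqrt_pos.2 (abs_pos.2 hω.ne))) (by exact_mod_cast hn)

theorem kMod_mem {L ω : ℝ} {n : ℕ} (hL : 0 < L) (hn : 1 ≤ n) (hω : ω < 0) :
    kMod L n ω ∈ modulusRange := SInv_mem (mul_sqrt_div_pos hL hn hω)

theorem profilePeriod_kMod {L ω : ℝ} {n : ℕ} (hL : 0 < L) (hn : 1 ≤ n) (hω : ω < 0) :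
    profilePeriod (kMod L n ω) ω = L / n := by
  have : √|ω| ≠ 0 := (Real.sqrt_pos.2 (abs_pos.2 hω.ne)).ne'
  rw [profilePeriod, kMod, S_SInv (mul_sqrt_div_pos hL hn hω)]
  field_simp

theorem kMod_eq_of_profilePeriod {L ω k : ℝ} {n : ℕ} (hn : 1 ≤ n) (hω : ω < 0)
    (hk : k ∈ modulusRange) (h : n * profilePeriod k ω = L) : kMod L n ω = k := by
  have : √|ω| ≠ 0 := (Real.sqrt_pos.2 (abs_pos.2 hω.ne)).ne'
  have hn0 : (n : ℝ) ≠ 0 := by positivity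
  have : L * √|ω| / n = S k := by
    rw [← h, profilePeriod]
    field_simp
  rw [kMod, this, SInv_S hk]

theorem cnoidal_eq_profile (L : ℝ) (n : ℕ) (ω : ℝ) :
    cnoidal L n ω = profile (kMod L n ω) ω := rfl

theorem gammaShift_eq_profileShift (L : ℝ) (n : ℕ) (ω : ℝ) :
    gammaShift L n ω = profileShift (kMod L n ω) ω := rfl

/-! ### Weak and classical derivatives -/

theorem exists_Icc_of_isCompact_subset_Ioo {a b : ℝ} (hab : a < b) {K : Set ℝ}
    (hK : IsCompact K) (hKs : K ⊆ Ioo a b) : ∃ c d, a < c ∧ c ≤ d ∧ d < b ∧ K ⊆ Icc c d := by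
  rcases K.eq_empty_or_nonempty with rfl | hne
  · exact ⟨(a + b) / 2, (a + b) / 2, by linarith, le_rfl, by linarith, empty_subset _⟩
  · have h1 := hKs (hK.sInf_mem hne)
    have h2 := hKs (hK.sSup_mem hne)
    exact ⟨sInf K, sSup K, h1.1, csInf_le_csSup hne hK.bddBelow hK.bddAbove, h2.2,
      fun x hx => ⟨csInf_le hK.bddBelow hx, le_csSup hK.bddAbove hx⟩⟩

/-- A test function of mean zero has a test function as primitive. -/
theorem exists_primitive_of_integral_eq_zero {L : ℝ} (hL : 0 < L) {ψ : ℝ → ℝ}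
    (hψ : ContDiff ℝ (⊤ : ℕ∞) ψ) (hc : HasCompactSupport ψ) (hs : tsupport ψ ⊆ Ioo 0 L)
    (h0 : ∫ x, ψ x = 0) :
    ∃ η : ℝ → ℝ, ContDiff ℝ (⊤ : ℕ∞) η ∧ HasCompactSupport η ∧ tsupport η ⊆ Ioo 0 L ∧
      deriv η = ψ := by
  obtain ⟨c, d, hc0, hcd, hdL, hsub⟩ := exists_Icc_of_isCompact_subset_Ioo hL hc hs
  have hzero : ∀ x, x ∉ Icc c d → ψ x = 0 := fun x hx =>
    image_eq_zero_of_notMem_tsupport fun h => hx (hsub h)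
  have hder : deriv (fun x => ∫ t in (0 : ℝ)..x, ψ t) = ψ :=
    funext fun x => hψ.continuous.deriv_integral ψ 0 x
  have hηsub : tsupport (fun x => ∫ t in (0 : ℝ)..x, ψ t) ⊆ Icc c d := by
    refine closure_minimal (fun x hx => ?_) isClosed_Icc
    by_contra hx'
    apply hx
    rw [mem_Icc, not_and_or, not_le, not_le] at hx'
    rcases hx' with hx' | hx'
    · refine (intervalIntegral.integral_congr (g := fun _ => (0 : ℝ)) fun t ht => ?_).trans
        (by simp)
      refine hzero t fun h => ?_
      rcases le_total 0 x with h' | h'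
      · rw [uIcc_of_le h'] at ht; linarith [ht.2, h.1]
      · rw [uIcc_of_ge h'] at ht; linarith [ht.2, h.1]
    · change ∫ t in (0 : ℝ)..x, ψ t = 0
      rw [← h0]
      refine intervalIntegral.integral_eq_integral_of_support_subset fun t ht => ?_
      have := hsub (subset_tsupport _ ht)
      exact ⟨by linarith [this.1], by linarith [this.2]⟩
  refine ⟨fun x => ∫ t in (0 : ℝ)..x, ψ t, ?_, ?_, ?_, hder⟩
  · refine contDiff_infty_iff_deriv.2 ⟨fun x => ?_, hder.symm ▸ hψ⟩
    exact (intervalIntegral.integral_hasDerivAt_right (hψ.continuous.intervalIntegrable _ _)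
      (hψ.continuous.stronglyMeasurableAtFilter _ _)
      hψ.continuous.continuousAt).differentiableAt
  · exact isCompact_Icc.of_isClosed_subset (isClosed_tsupport _) hηsub
  · exact hηsub.trans fun x hx => ⟨hc0.trans_le hx.1, hx.2.trans_lt hdL⟩

theorem integrable_mul_test {L : ℝ} {g η : ℝ → ℝ} (hg : IntegrableOn g (Ioo 0 L))
    (hη : Continuous η) (hc : HasCompactSupport η) :
    IntegrableOn (fun x => g x * η x) (Ioo 0 L) := by
  obtain ⟨C, hC⟩ := hc.exists_bound_of_continuous hη
  exact Integrable.mul_bdd hg hη.aestronglyMeasurable (Filter.Eventually.of_forall hC)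

/-- The lemma of du Bois-Reymond. -/
theorem exists_ae_eq_const_of_integral_mul_deriv_eq_zero {L : ℝ} (hL : 0 < L) {g : ℝ → ℝ}
    (hg : IntegrableOn g (Ioo 0 L))
    (h : ∀ η : ℝ → ℝ, ContDiff ℝ (⊤ : ℕ∞) η → HasCompactSupport η → tsupport η ⊆ Ioo 0 L →
      ∫ x in Ioo 0 L, g x * deriv η x = 0) :
    ∃ c : ℝ, ∀ᵐ x ∂(volume.restrict (Ioo 0 L)), g x = c := by
  let b : ContDiffBump (L / 2) := ⟨L / 8, L / 4, by positivity, by linarith⟩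
  set η₀ := b.normed volume with hη₀
  have hη₀d : ContDiff ℝ (⊤ : ℕ∞) η₀ := b.contDiff_normed
  have hη₀c : HasCompactSupport η₀ := b.hasCompactSupport_normed
  have hη₀s : tsupport η₀ ⊆ Ioo 0 L := by
    rw [hη₀, b.tsupport_normed_eq, Real.closedBall_eq_Icc]
    intro x hx
    have h1 : L / 2 - L / 4 ≤ x := hx.1
    have h2 : x ≤ L / 2 + L / 4 := hx.2
    exact ⟨by linarith, by linarith⟩
  have hη₀i : ∫ x, η₀ x = 1 := b.integral_normed
  refine ⟨∫ x in Ioo 0 L, g x * η₀ x, ?_⟩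
  set c := ∫ x in Ioo 0 L, g x * η₀ x with hc
  have hgc : IntegrableOn (fun x => g x - c) (Ioo 0 L) :=
    hg.sub (integrableOn_const (by simp))
  rw [ae_restrict_iff' measurableSet_Ioo]
  have := isOpen_Ioo.ae_eq_zero_of_integral_contDiff_smul_eq_zero (μ := volume)
    hgc.locallyIntegrableOn fun ψ hψ hψc hψs => ?_
  · filter_upwards [this] with x hx hmem
    linarith [hx hmem]
  -- Subtracting I times the bump of mass one leaves a test function of mean zero, hence a
  -- derivative of a test function, to which the hypothesis applies.
  set I := ∫ x, ψ x with hI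
  have hψint : Integrable ψ := hψ.continuous.integrable_of_hasCompactSupport hψc
  have hηint : Integrable η₀ := hη₀d.continuous.integrable_of_hasCompactSupport hη₀c
  have hsupp : ∀ x, x ∉ tsupport ψ ∪ tsupport η₀ → ψ x - I * η₀ x = 0 := fun x hx => by
    rw [mem_union, not_or] at hx
    rw [image_eq_zero_of_notMem_tsupport hx.1, image_eq_zero_of_notMem_tsupport hx.2]
    simp
  have hsub : tsupport (fun x => ψ x - I * η₀ x) ⊆ tsupport ψ ∪ tsupport η₀ :=
    closure_minimal (fun x hx => by
      by_contra hx'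
      exact hx (hsupp x hx')) ((isClosed_tsupport _).union (isClosed_tsupport _))
  obtain ⟨η, h1, h2, h3, h4⟩ := exists_primitive_of_integral_eq_zero hL
    (ψ := fun x => ψ x - I * η₀ x) (hψ.sub (contDiff_const.mul hη₀d))
    ((hψc.isCompact.union hη₀c.isCompact).of_isClosed_subset (isClosed_tsupport _) hsub)
    (hsub.trans (union_subset hψs hη₀s)) (by
      rw [integral_sub hψint (hηint.const_mul _), integral_const_mul, hη₀i, ← hI]; ring)
  have h5 := h η h1 h2 h3
  rw [h4] at h5
  have hgψ := integrable_mul_test hg hψ.continuous hψc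
  have hgη := integrable_mul_test hg hη₀d.continuous hη₀c
  have h6 : ∫ x in Ioo 0 L, g x * (ψ x - I * η₀ x) =
      (∫ x in Ioo 0 L, g x * ψ x) - I * c := by
    rw [hc, ← integral_const_mul, ← integral_sub hgψ (hgη.const_mul I)]
    congr 1
    ext x
    ring
  have hψI : ∫ x in Ioo 0 L, ψ x = I :=
    setIntegral_eq_integral_of_forall_compl_eq_zero fun x hx =>
      image_eq_zero_of_notMem_tsupport fun hx' => hx (hψs hx')
  have hout : ∫ x, ψ x • (g x - c) = ∫ x in Ioo 0 L, ψ x • (g x - c) :=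
    (setIntegral_eq_integral_of_forall_compl_eq_zero fun x hx => by
      rw [image_eq_zero_of_notMem_tsupport fun hx' => hx (hψs hx'), zero_smul]).symm
  rw [hout]
  have h7 : ∫ x in Ioo 0 L, ψ x • (g x - c) =
      (∫ x in Ioo 0 L, g x * ψ x) - c * ∫ x in Ioo 0 L, ψ x := by
    rw [← integral_const_mul, ← integral_sub hgψ (hψint.integrableOn.const_mul c)]
    congr 1
    ext x
    simp only [smul_eq_mul]
    ring
  rw [h7, hψI]
  linarith

/-- A classical derivative is a weak derivative. -/
theorem isWeakDeriv_of_hasDerivAt {L : ℝ} (hL : 0 < L) {u v : ℝ → ℝ}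
    (h : ∀ x, HasDerivAt u (v x) x) (hv : Continuous v) : IsWeakDeriv L u v := by
  intro η hη hc hs
  have hηd : ∀ x, HasDerivAt η (deriv η x) x := fun x =>
    (hη.differentiable (by simp) x).hasDerivAt
  have hη' : Continuous (deriv η) := hη.continuous_deriv (by simp)
  have hu : Continuous u := continuous_iff_continuousAt.2 fun x => (h x).continuousAt
  have hibp := intervalIntegral.integral_mul_deriv_eq_deriv_mul (a := 0) (b := L)
    (fun x _ => h x) (fun x _ => hηd x) (hv.intervalIntegrable _ _) (hη'.intervalIntegrable _ _)
  have h0 : η 0 = 0 := image_eq_zero_of_notMem_tsupport fun h => (hs h).1.false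
  have h1 : η L = 0 := image_eq_zero_of_notMem_tsupport fun h => (hs h).2.false
  rw [h0, h1, mul_zero, mul_zero, sub_zero, zero_sub, intervalIntegral.integral_of_le hL.le,
    intervalIntegral.integral_of_le hL.le, integral_Ioc_eq_integral_Ioo,
    integral_Ioc_eq_integral_Ioo] at hibp
  exact hibp

theorem memLp_two_of_continuous {L : ℝ} {u : ℝ → ℝ} (hu : Continuous u) :
    MemLp u 2 (volume.restrict (Ioo 0 L)) := by
  obtain ⟨C, hC⟩ := isCompact_Icc.exists_bound_of_continuousOn (s := Icc 0 L) hu.continuousOn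
  exact MemLp.of_bound hu.aestronglyMeasurable C (ae_restrict_of_forall_mem measurableSet_Ioo
    fun x hx => hC x (Ioo_subset_Icc_self hx))

/-- A function with a continuous weak derivative is a.e. equal to a `C¹` function. -/
theorem exists_hasDerivAt_of_isWeakDeriv {L : ℝ} (hL : 0 < L) {v w f : ℝ → ℝ}
    (hv : IntegrableOn v (Ioo 0 L)) (h : IsWeakDeriv L v w) (hf : Continuous f)
    (hw : ∀ᵐ x ∂(volume.restrict (Ioo 0 L)), w x = f x) :
    ∃ V : ℝ → ℝ, (∀ x, HasDerivAt V (f x) x) ∧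
      ∀ᵐ x ∂(volume.restrict (Ioo 0 L)), v x = V x := by
  set F : ℝ → ℝ := fun x => ∫ t in (0 : ℝ)..x, f t with hF
  have hFd : ∀ x, HasDerivAt F (f x) x := fun x =>
    intervalIntegral.integral_hasDerivAt_right (hf.intervalIntegrable _ _)
      (hf.stronglyMeasurableAtFilter _ _) hf.continuousAt
  have hFc : Continuous F := continuous_iff_continuousAt.2 fun x => (hFd x).continuousAt
  have hFi : IntegrableOn F (Ioo 0 L) :=
    (hFc.continuousOn.integrableOn_Icc).mono_set Ioo_subset_Icc_self
  obtain ⟨c, hc⟩ := exists_ae_eq_const_of_integral_mul_deriv_eq_zero hL (hv.sub hFi)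
    fun η h1 h2 h3 => by
      have hc1 : Continuous (deriv η) := h1.continuous_deriv (by simp)
      have hc2 : HasCompactSupport (deriv η) := h2.deriv
      have e1 := h η h1 h2 h3
      have e2 := isWeakDeriv_of_hasDerivAt hL hFd hf η h1 h2 h3
      have e3 : ∫ x in Ioo 0 L, w x * η x = ∫ x in Ioo 0 L, f x * η x :=
        integral_congr_ae (hw.mono fun x hx => by simp only [hx])
      have e4 := integral_sub (integrable_mul_test hv hc1 hc2) (integrable_mul_test hFi hc1 hc2)
      rw [e1, e2, e3, sub_self] at e4
      refine Eq.trans ?_ e4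
      refine integral_congr_ae (Filter.Eventually.of_forall fun x => ?_)
      change (v x - F x) * deriv η x = v x * deriv η x - F x * deriv η x
      ring
  refine ⟨fun x => F x + c, fun x => (hFd x).add_const c, hc.mono fun x hx => ?_⟩
  change v x - F x = c at hx
  linarith

/-- `u` is a classical solution of `u' = v`, `v' = -ω u - u³` on `[0, L]`. -/
def IsClassicalSolution (L ω : ℝ) (u v : ℝ → ℝ) : Prop :=
  ∀ x ∈ Icc 0 L, HasDerivWithinAt u (v x) (Icc 0 L) x ∧
    HasDerivWithinAt v (-(ω * u x) - u x ^ 3) (Icc 0 L) x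

/-- Bootstrapping: continuity of u makes the weak second derivative a.e. equal to a continuous
function, and integrating twice gives a C² function that agrees with u on the closed interval by
continuity. -/
theorem SolvesNLS.exists_isClassicalSolution {L ω : ℝ} (hL : 0 < L) {u : ℝ → ℝ}
    (hu : ContinuousOn u (Icc 0 L)) (h : SolvesNLS L ω u) :
    ∃ v, IsClassicalSolution L ω u v := by
  obtain ⟨v, w, hH, heq⟩ := h
  set f : ℝ → ℝ := fun x => -(ω * u x) - u x ^ 3 with hf
  have hfc : ContinuousOn f (Icc 0 L) := by fun_prop
  -- Nothing is known about u outside [0, L]; extending the right-hand side by its end values makes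
  -- it continuous on the line.
  set fe : ℝ → ℝ := IccExtend hL.le ((Icc 0 L).domRestrict f) with hfe
  have hfec : Continuous fe := hfc.domRestrict.Icc_extend'
  have hfeq : ∀ x ∈ Icc 0 L, fe x = f x := fun x hx => by
    rw [hfe, IccExtend_of_mem hL.le _ hx]; rfl
  obtain ⟨V, hV, hVv⟩ := exists_hasDerivAt_of_isWeakDeriv hL
    (hH.memLp_fst.integrable one_le_two) hH.weakDeriv_snd hfec (by
      filter_upwards [heq, ae_restrict_mem measurableSet_Ioo] with x hx hmem
      rw [hfeq x (Ioo_subset_Icc_self hmem)]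
      simp only [hf]
      linarith)
  have hVc : Continuous V := continuous_iff_continuousAt.2 fun x => (hV x).continuousAt
  obtain ⟨U, hU, hUu⟩ := exists_hasDerivAt_of_isWeakDeriv hL
    (hH.memLp.integrable one_le_two) hH.weakDeriv_fst hVc hVv
  have hUc : Continuous U := continuous_iff_continuousAt.2 fun x => (hU x).continuousAt
  have hEq : EqOn u U (Icc 0 L) := Measure.eqOn_Icc_of_ae_eq volume hL.ne
    (by rw [← restrict_Ioo_eq_restrict_Icc]; exact hUu) hu hUc.continuousOn
  refine ⟨V, fun x hx => ⟨((hU x).hasDerivWithinAt).congr hEq (hEq hx), ?_⟩⟩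
  have h := (hV x).hasDerivWithinAt (s := Icc 0 L)
  rwa [hfeq x hx] at h

theorem solvesP_of_hasDerivAt {ε L L₁ ω : ℝ} (hL : 0 < L) (hω : ω < 0) {u v : ℝ → ℝ}
    (hu : ∀ x, HasDerivAt u (v x) x) (hv : ∀ x, HasDerivAt v (-(ω * u x) - u x ^ 3) x)
    (h0 : u 0 = u L) (h1 : v 0 = v L) (h2 : u 0 = √(2 * |ω|)) (h3 : ε * u L₁ = √(2 * |ω|)) :
    SolvesP ε L L₁ ω u := by
  have huc : Continuous u := continuous_iff_continuousAt.2 fun x => (hu x).continuousAt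
  have hvc : Continuous v := continuous_iff_continuousAt.2 fun x => (hv x).continuousAt
  have hwc : Continuous fun x => -(ω * u x) - u x ^ 3 := by fun_prop
  have hH : IsH2With L u v fun x => -(ω * u x) - u x ^ 3 :=
    ⟨memLp_two_of_continuous huc, memLp_two_of_continuous hvc, memLp_two_of_continuous hwc,
      isWeakDeriv_of_hasDerivAt hL hu hvc, isWeakDeriv_of_hasDerivAt hL hv hwc⟩
  have hdw : ∀ x ∈ Icc 0 L, derivWithin u (Icc 0 L) x = v x := fun x hx =>
    (hu x).hasDerivWithinAt.derivWithin (uniqueDiffOn_Icc hL x hx)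
  refine ⟨hω, ⟨huc.continuousOn, ⟨_, _, hH⟩, h0, ?_⟩, ⟨_, _, hH, ?_⟩, h2, h3⟩
  · rw [hdw 0 ⟨le_rfl, hL.le⟩, hdw L ⟨hL.le, le_rfl⟩, h1]
  · exact Filter.Eventually.of_forall fun x => by ring

/-! ### Uniqueness for the initial value problem -/

theorem IsClassicalSolution.eqOn {L ω : ℝ} {u v u' v' : ℝ → ℝ}
    (h : IsClassicalSolution L ω u v) (h' : IsClassicalSolution L ω u' v')
    (hu : u 0 = u' 0) (hv : v 0 = v' 0) : EqOn u u' (Icc 0 L) ∧ EqOn v v' (Icc 0 L) := by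
  set F : ℝ × ℝ → ℝ × ℝ := fun p => (p.2, -(ω * p.1) - p.1 ^ 3) with hF
  have hFd : ContDiff ℝ 1 F := by fun_prop
  have key : ∀ {u v : ℝ → ℝ}, IsClassicalSolution L ω u v →
      ContinuousOn (fun x => (u x, v x)) (Icc 0 L) ∧
      ∀ t ∈ Ico 0 L, HasDerivWithinAt (fun x => (u x, v x)) (F (u t, v t)) (Ici t) t := by
    intro u v h
    refine ⟨fun x hx => ((h x hx).1.continuousWithinAt.prodMk (h x hx).2.continuousWithinAt),
      fun t ht => ?_⟩
    have ht' := h t (Ico_subset_Icc_self ht)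
    exact (ht'.1.prodMk ht'.2).mono_of_mem_nhdsWithin
      (Filter.mem_of_superset (Icc_mem_nhdsGE ht.2) (Icc_subset_Icc_left ht.1))
  obtain ⟨hc1, hd1⟩ := key h
  obtain ⟨hc2, hd2⟩ := key h'
  -- The cubic field is not globally Lipschitz, but it is Lipschitz on the compact union of the two
  -- orbits.
  obtain ⟨K, hK⟩ := (hFd.locallyLipschitz.locallyLipschitzOn
    (s := (fun x => (u x, v x)) '' Icc 0 L ∪ (fun x => (u' x, v' x)) '' Icc 0 L)
    ).exists_lipschitzOnWith_of_compact
      ((isCompact_Icc.image_of_continuousOn hc1).union (isCompact_Icc.image_of_continuousOn hc2))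
  have huniq := ODE_solution_unique_of_mem_Icc_right (v := fun _ => F) (fun _ _ => hK)
    hc1 hd1 (fun t ht => Or.inl ⟨t, Ico_subset_Icc_self ht, rfl⟩)
    hc2 hd2 (fun t ht => Or.inr ⟨t, Ico_subset_Icc_self ht, rfl⟩) (by simp only [hu, hv])
  exact ⟨fun x hx => congrArg Prod.fst (huniq hx), fun x hx => congrArg Prod.snd (huniq hx)⟩

/-! ### The solitary wave -/

/-- For a = √|ω| this solution starts at height √(2|ω|) with slope zero, the one slope that no
cnoidal wave has at this height. -/
theorem isClassicalSolution_sech (L a : ℝ) :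
    IsClassicalSolution L (-a ^ 2) (fun x => √2 * a / Real.cosh (a * x))
      (fun x => -(√2 * a ^ 2 * Real.sinh (a * x)) / Real.cosh (a * x) ^ 2) := by
  intro x _
  have hlin : HasDerivAt (fun x => a * x) a x := by simpa using (hasDerivAt_id x).const_mul a
  have hc := hlin.cosh
  have hs := hlin.sinh
  have hne : Real.cosh (a * x) ≠ 0 := (Real.cosh_pos _).ne'
  have h2 : √2 ^ 2 = 2 := Real.sq_sqrt (by norm_num)
  have hcs := Real.cosh_sq (a * x)
  constructor
  · refine (((hasDerivAt_const x (√2 * a)).div hc hne).congr_deriv ?_).hasDerivWithinAt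
    ring
  · refine (((hs.const_mul (√2 * a ^ 2)).neg.div (hc.pow 2)
      (pow_ne_zero 2 hne)).congr_deriv ?_).hasDerivWithinAt
    simp only [Pi.pow_apply, Pi.neg_apply]
    generalize Real.cosh (a * x) = C at *
    generalize Real.sinh (a * x) = s at *
    field_simp
    rw [show 2 - 1 = 1 from rfl, Nat.cast_ofNat]
    linear_combination (a ^ 3 * C) * h2 - (2 * a ^ 3 * C) * hcs

/-! ### Classification of the periodic solutions -/

theorem isClassicalSolution_profile {L ω k : ℝ} (hk : k ∈ modulusRange) (hω : ω < 0) (s : ℝ) :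
    IsClassicalSolution L ω (fun x => profile k ω (x + s)) (fun x => profileDeriv k ω (x + s)) :=
  fun x _ => ⟨(HasDerivAt.comp_add_const x s (hasDerivAt_profile hk (x + s))).hasDerivWithinAt,
    (HasDerivAt.comp_add_const x s (hasDerivAt_profileDeriv hk hω (x + s))).hasDerivWithinAt⟩

/-- A periodic solution starting at height `√(2|ω|)` is not the solitary wave. -/
theorem IsClassicalSolution.deriv_zero_ne_zero {L ω : ℝ} {u v : ℝ → ℝ} (hL : 0 < L) (hω : ω < 0)
    (h : IsClassicalSolution L ω u v) (h0 : u 0 = √(2 * |ω|)) (hper : u 0 = u L) : v 0 ≠ 0 := by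
  intro hv
  have ha : 0 < √|ω| := Real.sqrt_pos.2 (abs_pos.2 hω.ne)
  have hsq : √|ω| ^ 2 = |ω| := Real.sq_sqrt (abs_nonneg _)
  have hs := isClassicalSolution_sech L √|ω|
  rw [hsq, abs_of_neg hω, neg_neg] at hs
  rw [Real.sqrt_mul zero_le_two, abs_of_neg hω] at h0
  rw [abs_of_neg hω] at ha
  -- By uniqueness u would be the solitary wave, which at L is strictly below its maximum u(0).
  have heq := (h.eqOn hs (by simp [h0]) (by simp [hv])).1 (right_mem_Icc.2 hL.le)
  rw [← hper, h0] at heq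
  have hcosh : 1 < Real.cosh (√(-ω) * L) := Real.one_lt_cosh.2 (mul_pos ha hL).ne'
  have hlt : √2 * √(-ω) / Real.cosh (√(-ω) * L) < √2 * √(-ω) :=
    div_lt_self (by positivity) hcosh
  exact hlt.ne heq.symm

/-- The periodic solutions starting at height `√(2|ω|)` are shifted cnoidal waves. -/
theorem IsClassicalSolution.exists_eq_cnoidal {L ω : ℝ} {u v : ℝ → ℝ} (hL : 0 < L) (hω : ω < 0)
    (h : IsClassicalSolution L ω u v) (h0 : u 0 = √(2 * |ω|)) (hper : u 0 = u L)
    (hperv : v 0 = v L) : ∃ n : ℕ, 1 ≤ n ∧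
      (EqOn u (uTildePlus L n ω) (Icc 0 L) ∨ EqOn u (uTildeMinus L n ω) (Icc 0 L)) := by
  obtain ⟨k, hk, hslope⟩ := exists_modulus_slope_sq hω (h.deriv_zero_ne_zero hL hω h0 hper)
  have hsgn : ∃ s, (s = profileShift k ω ∨ s = -profileShift k ω) ∧ v 0 = profileDeriv k ω s := by
    rcases sq_eq_sq_iff_eq_or_eq_neg.1 hslope with h | h
    · exact ⟨_, Or.inl rfl, h.symm⟩
    · exact ⟨_, Or.inr rfl, by rw [profileDeriv_neg hk, h, neg_neg]⟩
  obtain ⟨s, hs, hvs⟩ := hsgn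
  have hus : profile k ω s = √(2 * |ω|) := by
    rcases hs with rfl | rfl
    · exact profile_profileShift hk hω
    · rw [profile_neg hk, profile_profileShift hk hω]
  obtain ⟨hEq, hEqv⟩ := h.eqOn (isClassicalSolution_profile hk hω s) (by simp [h0, hus])
    (by simp [hvs])
  have hLmem : L ∈ Icc 0 L := right_mem_Icc.2 hL.le
  -- Value and slope agree at 0 and L, so the phase point is the same and L is an integer multiple
  -- of the period.
  obtain ⟨m, hm⟩ := eq_add_period_of_profile_eq hk hω (y := s) (z := L + s)
    (by rw [hus, ← h0, hper]; exact hEq hLmem) (by rw [← hvs, hperv]; exact hEqv hLmem)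
  have hT := profilePeriod_pos hk hω
  have hmT : m * profilePeriod k ω = L := by linarith
  have hm0 : 0 < m := by
    by_contra hneg
    have : (m : ℝ) ≤ 0 := by exact_mod_cast not_lt.1 hneg
    nlinarith
  lift m to ℕ using hm0.le
  have hn : 1 ≤ m := by exact_mod_cast hm0
  have hkm : kMod L m ω = k := kMod_eq_of_profilePeriod hn hω hk (by exact_mod_cast hmT)
  refine ⟨m, hn, ?_⟩
  refine hs.imp (fun hs => ?_) (fun hs => ?_)
  · intro x hx
    rw [hEq hx, hs, uTildePlus, gammaShift_eq_profileShift, cnoidal_eq_profile, hkm]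
  · intro x hx
    rw [hEq hx, hs, uTildeMinus, gammaShift_eq_profileShift, cnoidal_eq_profile, hkm,
      sub_eq_add_neg]

theorem SolvesP.exists_eqOn {ε L L₁ ω : ℝ} {u : ℝ → ℝ} (hL : 0 < L) (h : SolvesP ε L L₁ ω u) :
    ∃ n : ℕ, 1 ≤ n ∧
      (EqOn u (uTildePlus L n ω) (Icc 0 L) ∨ EqOn u (uTildeMinus L n ω) (Icc 0 L)) := by
  obtain ⟨v, hv⟩ := h.eqn.exists_isClassicalSolution hL h.mem.continuousOn
  refine hv.exists_eq_cnoidal hL h.neg h.left h.mem.periodic ?_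
  have hdw : ∀ x ∈ Icc 0 L, derivWithin u (Icc 0 L) x = v x := fun x hx =>
    (hv x hx).1.derivWithin (uniqueDiffOn_Icc hL x hx)
  rw [← hdw 0 ⟨le_rfl, hL.le⟩, ← hdw L ⟨hL.le, le_rfl⟩, h.mem.periodic_deriv]

theorem solvesP_shifted_cnoidal {ε L L₁ ω s : ℝ} {n : ℕ} (hL : 0 < L) (hn : 1 ≤ n) (hω : ω < 0)
    (h0 : cnoidal L n ω s = √(2 * |ω|)) (h1 : ε * cnoidal L n ω (L₁ + s) = √(2 * |ω|)) :
    SolvesP ε L L₁ ω fun x => cnoidal L n ω (x + s) := by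
  have hk := kMod_mem hL hn hω
  have hT := profilePeriod_kMod hL hn hω
  have hLs : L + s = s + (n : ℤ) * (2 * (profilePeriod (kMod L n ω) ω / 2)) := by
    have : (n : ℝ) ≠ 0 := by positivity
    rw [hT]
    push_cast
    field_simp
    ring
  refine solvesP_of_hasDerivAt hL hω (v := fun x => profileDeriv (kMod L n ω) ω (x + s))
    (fun x => HasDerivAt.comp_add_const x s (hasDerivAt_profile hk (x + s)))
    (fun x => HasDerivAt.comp_add_const x s (hasDerivAt_profileDeriv hk hω (x + s)))
    ?_ ?_ (by simpa using h0) h1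
  · rw [hLs, zero_add, cnoidal_eq_profile]
    exact ((profile_antiperiodic hk hω).periodic_two_mul.int_mul n s).symm
  · rw [hLs, zero_add]
    exact ((profileDeriv_antiperiodic hk hω).periodic_two_mul.int_mul n s).symm

/-! ### The boundary conditions as congruences -/

/-- The condition `ε u(L₁) = √(2|ω|)` for shifted cnoidal waves; `δ` is `0` for `ε = 1` and `1/2`
for `ε = -1`, and `t` is the shift in units of half a period. -/
theorem cnoidal_right_iff {ε δ L L₁ ω t : ℝ} {n : ℕ} (hεδ : ε = 1 ∧ δ = 0 ∨ ε = -1 ∧ δ = 1 / 2)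
    (hL : 0 < L) (hn : 1 ≤ n) (hω : ω < 0) (h0 : cnoidal L n ω (t * (L / (2 * n))) = √(2 * |ω|)) :
    ε * cnoidal L n ω (L₁ + t * (L / (2 * n))) = √(2 * |ω|) ↔
      (∃ m : ℤ, L₁ / L * n + δ = m) ∨ ∃ m : ℤ, L₁ / L * n + δ + t = m := by
  have hk := kMod_mem hL hn hω
  have hT := profilePeriod_kMod hL hn hω
  have hn0 : (0 : ℝ) < n := by exact_mod_cast hn
  -- Antiperiodicity trades the sign for half a period, so both problems become one equation between
  -- two values of the profile.
  have hshift : ∀ y, ε * cnoidal L n ω y = cnoidal L n ω (y + δ * (L / n)) := by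
    intro y
    rcases hεδ with ⟨rfl, rfl⟩ | ⟨rfl, rfl⟩
    · simp
    · have := profile_antiperiodic hk hω y
      rw [cnoidal_eq_profile, ← hT, show 1 / 2 * profilePeriod (kMod L n ω) ω =
        profilePeriod (kMod L n ω) ω / 2 by ring, this]
      ring
  rw [hshift, ← h0, cnoidal_eq_profile, profile_eq_iff hk hω, hT]
  -- Equality of arguments modulo the period cancels t; in the reflected case `e2` the two copies of
  -- t add up to a full unit L/n.
  have e1 : ∀ m : ℝ, t * (L / (2 * n)) = L₁ + t * (L / (2 * n)) + δ * (L / n) + m * (L / n) ↔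
      L₁ / L * n + δ = -m := fun m => by
    field_simp
    constructor <;> intro h <;> linarith
  have e2 : ∀ m : ℝ, t * (L / (2 * n)) = -(L₁ + t * (L / (2 * n)) + δ * (L / n)) + m * (L / n) ↔
      L₁ / L * n + δ + t = m := fun m => by
    field_simp
    constructor <;> intro h <;> linarith
  simp only [e1, e2]
  constructor
  · rintro ⟨m, h | h⟩
    · exact Or.inl ⟨-m, by push_cast; exact h⟩
    · exact Or.inr ⟨m, h⟩
  · rintro (⟨m, h⟩ | ⟨m, h⟩)
    · exact ⟨-m, Or.inl (by push_cast; rw [neg_neg]; exact h)⟩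
    · exact ⟨m, Or.inr h⟩

theorem gammaShift_eq {L ω : ℝ} {n : ℕ} (hL : 0 < L) (hn : 1 ≤ n) (hω : ω < 0) :
    gammaShift L n ω = phi (kMod L n ω) / 2 * (L / (2 * n)) := by
  have hn0 : (0 : ℝ) < n := by exact_mod_cast hn
  rw [gammaShift_eq_profileShift, profileShift_eq (kMod_mem hL hn hω) hω,
    profilePeriod_kMod hL hn hω]
  field_simp
  norm_num

theorem uTildePlus_eq {L ω : ℝ} {n : ℕ} (hL : 0 < L) (hn : 1 ≤ n) (hω : ω < 0) :
    uTildePlus L n ω = fun x => cnoidal L n ω (x + phi (kMod L n ω) / 2 * (L / (2 * n))) := by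
  funext x
  rw [uTildePlus, gammaShift_eq hL hn hω]

theorem uTildeMinus_eq {L ω : ℝ} {n : ℕ} (hL : 0 < L) (hn : 1 ≤ n) (hω : ω < 0) :
    uTildeMinus L n ω =
      fun x => cnoidal L n ω (x + -(phi (kMod L n ω) / 2) * (L / (2 * n))) := by
  funext x
  rw [uTildeMinus, gammaShift_eq hL hn hω, neg_mul, sub_eq_add_neg]

theorem phi_kMod_pos {L ω : ℝ} {n : ℕ} (hL : 0 < L) (hn : 1 ≤ n) (hω : ω < 0) :
    0 < phi (kMod L n ω) := phi_pos (kMod_mem hL hn hω)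

/-- The pair consisting of `ω` and the cnoidal wave of index `n`, frequency `ω` and shift `t`. -/
noncomputable def shiftedPair (L : ℝ) (n : ℕ) (ω t : ℝ) : ℝ × (Icc (0 : ℝ) L → ℝ) :=
  (ω, onInterval L fun x => cnoidal L n ω (x + t * (L / (2 * n))))

theorem cnoidal_shift_zero {L ω t : ℝ} {n : ℕ} (hL : 0 < L) (hn : 1 ≤ n) (hω : ω < 0)
    (ht : |t| = phi (kMod L n ω) / 2) : cnoidal L n ω (t * (L / (2 * n))) = √(2 * |ω|) := by
  have hk := kMod_mem hL hn hω
  have hbase := profile_profileShift hk hω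
  rw [← gammaShift_eq_profileShift, gammaShift_eq hL hn hω, ← ht, ← cnoidal_eq_profile] at hbase
  rw [← hbase]
  rcases abs_choice t with h | h
  · rw [h]
  · rw [h, neg_mul, cnoidal_eq_profile, profile_neg hk]

/-- The analysis ends here: the two signs of t encode the two functions ũ, and only congruences
remain. -/
theorem exists_solvesP_iff {ε δ L L₁ : ℝ} (hεδ : ε = 1 ∧ δ = 0 ∨ ε = -1 ∧ δ = 1 / 2)
    (hL₁ : 0 < L₁) (hL : L₁ < L) (z : ℝ × (Icc (0 : ℝ) L → ℝ)) :
    (∃ ω u, SolvesP ε L L₁ ω u ∧ z = (ω, onInterval L u)) ↔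
      ∃ n : ℕ, 1 ≤ n ∧ ∃ ω < 0, ∃ t, |t| = phi (kMod L n ω) / 2 ∧
        ((∃ m : ℤ, L₁ / L * n + δ = m) ∨ ∃ m : ℤ, L₁ / L * n + δ + t = m) ∧
        z = shiftedPair L n ω t := by
  have hL0 := hL₁.trans hL
  constructor
  · rintro ⟨ω, u, hu, rfl⟩
    obtain ⟨n, hn, h⟩ := hu.exists_eqOn hL0
    have hφ := phi_kMod_pos hL0 hn hu.neg
    have : ∃ t, |t| = phi (kMod L n ω) / 2 ∧
        EqOn u (fun x => cnoidal L n ω (x + t * (L / (2 * n)))) (Icc 0 L) := by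
      rcases h with h | h
      · exact ⟨_, abs_of_pos (half_pos hφ), uTildePlus_eq hL0 hn hu.neg ▸ h⟩
      · exact ⟨_, by rw [abs_neg, abs_of_pos (half_pos hφ)], uTildeMinus_eq hL0 hn hu.neg ▸ h⟩
    obtain ⟨t, ht, hEq⟩ := this
    refine ⟨n, hn, ω, hu.neg, t, ht, ?_, ?_⟩
    · rw [← cnoidal_right_iff hεδ hL0 hn hu.neg (cnoidal_shift_zero hL0 hn hu.neg ht), ← hu.right,
        hEq ⟨hL₁.le, hL.le⟩]
    · rw [shiftedPair]
      congr 1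
      funext x
      exact hEq x.2
  · rintro ⟨n, hn, ω, hω, t, ht, hm, rfl⟩
    have h0 := cnoidal_shift_zero hL0 hn hω ht
    exact ⟨ω, _, solvesP_shifted_cnoidal hL0 hn hω h0 ((cnoidal_right_iff hεδ hL0 hn hω h0).2 hm),
      rfl⟩

theorem mem_branches_iff {L : ℝ} (hL : 0 < L) {A : Set ℕ} (hA : ∀ n ∈ A, 1 ≤ n)
    (z : ℝ × (Icc (0 : ℝ) L → ℝ)) :
    z ∈ branches L A ↔ ∃ n ∈ A, ∃ ω < 0, ∃ t, |t| = phi (kMod L n ω) / 2 ∧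
      z = shiftedPair L n ω t := by
  refine exists_congr fun n => and_congr_right fun hn => exists_congr fun ω =>
    and_congr_right fun hω => ?_
  rw [uTildePlus_eq hL (hA n hn) hω, uTildeMinus_eq hL (hA n hn) hω]
  have hφ := half_pos (phi_kMod_pos hL (hA n hn) hω)
  constructor
  · rintro (h | h)
    · exact ⟨_, abs_of_pos hφ, h⟩
    · exact ⟨_, by rw [abs_neg, abs_of_pos hφ], h⟩
  · rintro ⟨t, ht, h⟩
    rcases eq_or_eq_neg_of_abs_eq ht with rfl | rfl
    · exact Or.inl h
    · exact Or.inr h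

/-- Since S(k) = L√|ω|/n for k = `kMod L n ω`, prescribing φ(k) = y amounts to √|ω| = (n/L)
S(φ⁻¹(y)), which is where G comes from. -/
theorem phi_kMod_eq_iff {L ω y : ℝ} {n : ℕ} (hL : 0 < L) (hn : 1 ≤ n) (hω : ω < 0)
    (hy0 : 0 < y) (hy1 : y < 1) :
    phi (kMod L n ω) = y ↔ ω = -((n / L * G y) ^ 2) := by
  have hn0 : (0 : ℝ) < n := by exact_mod_cast hn
  have hk := kMod_mem hL hn hω
  have hsq : √|ω| ^ 2 = -ω := by rw [Real.sq_sqrt (abs_nonneg _), abs_of_neg hω]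
  constructor
  · rintro rfl
    have hS : S (kMod L n ω) = L * √|ω| / n := S_SInv (mul_sqrt_div_pos hL hn hω)
    rw [G, phiInv_phi hk, hS]
    have : (n : ℝ) / L * (L * √|ω| / n) = √|ω| := by field_simp
    rw [this, hsq, neg_neg]
  · intro h
    have hmem := phiInv_mem hy0 hy1
    have hG : 0 < G y := S_pos hmem
    have hroot : √|ω| = n / L * G y := by
      rw [h, abs_neg, abs_of_nonneg (sq_nonneg _), Real.sqrt_sq (by positivity)]
    have : L * √|ω| / n = S (phiInv y) := by
      rw [hroot, G]
      field_simp
    rw [kMod, this, SInv_S hmem, phi_phiInv hy0 hy1]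

theorem eq_isolated_pair_iff {L τ : ℝ} {n : ℕ} (hL : 0 < L) (hn : 1 ≤ n) (hτ0 : 0 < |τ|)
    (hτ1 : |τ| < 1 / 2) (z : ℝ × (Icc (0 : ℝ) L → ℝ)) :
    z = shiftedPair L n (-((n / L * G (2 * |τ|)) ^ 2)) τ ↔
      ∃ ω < 0, |τ| = phi (kMod L n ω) / 2 ∧ z = shiftedPair L n ω τ := by
  have hy0 : 0 < 2 * |τ| := by linarith
  have hy1 : 2 * |τ| < 1 := by linarith
  have hG : 0 < G (2 * |τ|) := S_pos (phiInv_mem hy0 hy1)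
  have hn0 : (0 : ℝ) < n := by exact_mod_cast hn
  constructor
  · intro h
    have hω : -((n / L * G (2 * |τ|)) ^ 2) < 0 := neg_neg_of_pos (by positivity)
    refine ⟨_, hω, ?_, h⟩
    rw [(phi_kMod_eq_iff hL hn hω hy0 hy1).2 rfl]
    ring
  · rintro ⟨ω, hω, ht, h⟩
    rwa [← (phi_kMod_eq_iff hL hn hω hy0 hy1).1 (by linarith)]

/-! ### The fractional parts -/

/-- The interval is half open, so a half-integer ratio always appears as -1/2 and never as 1/2. -/
theorem exists_rSeq (L L₁ : ℝ) (n : ℕ) :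
    ∃ j : ℤ, L₁ / L * n = j + rSeq L L₁ n ∧ -(1 / 2) ≤ rSeq L L₁ n ∧ rSeq L L₁ n < 1 / 2 := by
  have h1 := Int.floor_le (L₁ / L * n + 1 / 2)
  have h2 := Int.lt_floor_add_one (L₁ / L * n + 1 / 2)
  refine ⟨_, (add_sub_cancel _ _).symm, ?_, ?_⟩ <;> rw [rSeq] <;> linarith

theorem rSeq_eq_zero_iff {L L₁ : ℝ} {n : ℕ} :
    rSeq L L₁ n = 0 ↔ ∃ m : ℤ, L₁ / L * n = m := by
  obtain ⟨j, hj, h1, h2⟩ := exists_rSeq L L₁ n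
  constructor
  · intro h
    exact ⟨j, by rw [hj, h, add_zero]⟩
  · rintro ⟨m, hm⟩
    have : rSeq L L₁ n = ((m - j : ℤ) : ℝ) := by push_cast; linarith
    rw [this] at h1 h2 ⊢
    have h3 : m - j < 1 := by
      have : ((m - j : ℤ) : ℝ) < 1 := by linarith
      exact_mod_cast this
    have h4 : -1 < m - j := by
      have : (-1 : ℝ) < ((m - j : ℤ) : ℝ) := by linarith
      exact_mod_cast this
    have : m - j = 0 := by omega
    rw [this, Int.cast_zero]

theorem rSeq_eq_neg_half_iff {L L₁ : ℝ} {n : ℕ} :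
    rSeq L L₁ n = -(1 / 2) ↔ ∃ m : ℤ, L₁ / L * n + 1 / 2 = m := by
  obtain ⟨j, hj, h1, h2⟩ := exists_rSeq L L₁ n
  constructor
  · intro h
    exact ⟨j, by rw [hj, h]; ring⟩
  · rintro ⟨m, hm⟩
    have : rSeq L L₁ n = ((m - j : ℤ) : ℝ) - 1 / 2 := by push_cast; linarith
    rw [this] at h1 h2 ⊢
    have h3 : m - j < 1 := by
      have : ((m - j : ℤ) : ℝ) < 1 := by linarith
      exact_mod_cast this
    have h4 : -1 < m - j := by
      have : (-1 : ℝ) < ((m - j : ℤ) : ℝ) := by linarith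
      exact_mod_cast this
    have : m - j = 0 := by omega
    rw [this, Int.cast_zero, zero_sub]

theorem abs_rSeq_bounds {L L₁ : ℝ} {n : ℕ} (h0 : rSeq L L₁ n ≠ 0) (h1 : rSeq L L₁ n ≠ -(1 / 2)) :
    0 < |rSeq L L₁ n| ∧ |rSeq L L₁ n| < 1 / 2 := by
  obtain ⟨-, -, h2, h3⟩ := exists_rSeq L L₁ n
  exact ⟨abs_pos.2 h0, abs_lt.2 ⟨lt_of_le_of_ne h2 h1.symm, h3⟩⟩

/-- The sum of `rSeq` and t is an integer strictly between -1 and 1, hence zero. -/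
theorem int_shift_iff_plus {L L₁ t : ℝ} {n : ℕ} (ht0 : 0 < |t|) (ht1 : |t| < 1 / 2) :
    (∃ m : ℤ, L₁ / L * n + t = m) ↔ rSeq L L₁ n ≠ 0 ∧ rSeq L L₁ n ≠ -(1 / 2) ∧
      t = -rSeq L L₁ n := by
  obtain ⟨j, hj, h1, h2⟩ := exists_rSeq L L₁ n
  obtain ⟨ht2, ht3⟩ := abs_lt.1 ht1
  constructor
  · rintro ⟨m, hm⟩
    have h3 : rSeq L L₁ n + t = ((m - j : ℤ) : ℝ) := by push_cast; linarith
    have h4 : m - j < 1 := by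
      have : ((m - j : ℤ) : ℝ) < 1 := by linarith
      exact_mod_cast this
    have h5 : -1 < m - j := by
      have : (-1 : ℝ) < ((m - j : ℤ) : ℝ) := by linarith
      exact_mod_cast this
    rw [show m - j = 0 by omega, Int.cast_zero] at h3
    have h6 : t = -rSeq L L₁ n := by linarith
    refine ⟨fun h => ?_, fun h => by linarith, h6⟩
    rw [h6, h, neg_zero, abs_zero] at ht0
    exact ht0.false
  · rintro ⟨-, -, h⟩
    exact ⟨j, by rw [hj, h]; ring⟩

/-- Writing r for `rSeq L L₁ n`, the integer r + 1/2 + t lies between -1/2 and 3/2. It is 0 for r <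
0 and 1 for r > 0, which produces the sign factor; r = 0 would force t = -1/2. -/
theorem int_shift_iff_minus {L L₁ t : ℝ} {n : ℕ} (ht0 : 0 < |t|) (ht1 : |t| < 1 / 2)
    (hhalf : rSeq L L₁ n ≠ -(1 / 2)) :
    (∃ m : ℤ, L₁ / L * n + 1 / 2 + t = m) ↔ rSeq L L₁ n ≠ 0 ∧
      t = (1 / 2 - |rSeq L L₁ n|) * Real.sign (rSeq L L₁ n) := by
  obtain ⟨j, hj, h1, h2⟩ := exists_rSeq L L₁ n
  obtain ⟨ht2, ht3⟩ := abs_lt.1 ht1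
  have h1' := lt_of_le_of_ne h1 hhalf.symm
  constructor
  · rintro ⟨m, hm⟩
    have h3 : rSeq L L₁ n + 1 / 2 + t = ((m - j : ℤ) : ℝ) := by push_cast; linarith
    have h4 : m - j < 2 := by
      have : ((m - j : ℤ) : ℝ) < 2 := by linarith
      exact_mod_cast this
    have h5 : -1 < m - j := by
      have : (-1 : ℝ) < ((m - j : ℤ) : ℝ) := by linarith
      exact_mod_cast this
    rcases lt_trichotomy (rSeq L L₁ n) 0 with hr | hr | hr
    · refine ⟨hr.ne, ?_⟩
      have h6 : m - j < 1 := by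
        have : ((m - j : ℤ) : ℝ) < 1 := by linarith
        exact_mod_cast this
      rw [show m - j = 0 by omega, Int.cast_zero] at h3
      rw [Real.sign_of_neg hr, abs_of_neg hr]
      linarith
    · exfalso
      have h6 : m - j < 1 := by
        have : ((m - j : ℤ) : ℝ) < 1 := by linarith
        exact_mod_cast this
      rw [show m - j = 0 by omega, Int.cast_zero] at h3
      linarith
    · refine ⟨hr.ne', ?_⟩
      have h6 : 0 < m - j := by
        have : (0 : ℝ) < ((m - j : ℤ) : ℝ) := by linarith
        exact_mod_cast this
      rw [show m - j = 1 by omega, Int.cast_one] at h3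
      rw [Real.sign_of_pos hr, abs_of_pos hr]
      linarith
  · rintro ⟨hr, h⟩
    rcases hr.lt_or_gt with hr | hr
    · rw [Real.sign_of_neg hr, abs_of_neg hr] at h
      exact ⟨j, by rw [hj, h]; ring⟩
    · rw [Real.sign_of_pos hr, abs_of_pos hr] at h
      exact ⟨j + 1, by rw [hj, h]; push_cast; ring⟩

theorem abs_minus_shift {L L₁ : ℝ} {n : ℕ} (h0 : rSeq L L₁ n ≠ 0) (h1 : rSeq L L₁ n ≠ -(1 / 2)) :
    |(1 / 2 - |rSeq L L₁ n|) * Real.sign (rSeq L L₁ n)| = 1 / 2 - |rSeq L L₁ n| := by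
  have h2 := (abs_rSeq_bounds h0 h1).2
  rw [abs_mul, abs_of_pos (by linarith)]
  rcases h0.lt_or_gt with hr | hr
  · rw [Real.sign_of_neg hr]; simp
  · rw [Real.sign_of_pos hr]; simp

/-! ### The solution sets in terms of the fractional parts -/

theorem isolatedPlus_pair_eq {L : ℝ} (L₁ : ℝ) (n : ℕ) :
    (omegaPlus L L₁ n, onInterval L (uPlus L L₁ n)) =
      shiftedPair L n (-((n / L * G (2 * |-rSeq L L₁ n|)) ^ 2)) (-rSeq L L₁ n) := by
  rw [abs_neg, shiftedPair]
  change _ = (omegaPlus L L₁ n, _)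
  congr 2
  funext x
  rw [uPlus, sPlus]
  congr 1
  ring

theorem isolatedMinus_pair_eq {L L₁ : ℝ} {n : ℕ} (h0 : rSeq L L₁ n ≠ 0)
    (h1 : rSeq L L₁ n ≠ -(1 / 2)) :
    (omegaMinus L L₁ n, onInterval L (uMinus L L₁ n)) =
      shiftedPair L n (-((n / L * G (2 * |(1 / 2 - |rSeq L L₁ n|) *
        Real.sign (rSeq L L₁ n)|)) ^ 2)) ((1 / 2 - |rSeq L L₁ n|) * Real.sign (rSeq L L₁ n)) := by
  rw [abs_minus_shift h0 h1, shiftedPair,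
    show 2 * (1 / 2 - |rSeq L L₁ n|) = 1 - xiSeq L L₁ n by rw [xiSeq]; ring]
  change _ = (omegaMinus L L₁ n, _)
  congr 2
  funext x
  rw [uMinus, sMinus]
  congr 1
  ring

/-- The solutions of `(P₊)` in terms of the fractional parts `r_n`. -/
theorem solutionsPplus_eq {L L₁ : ℝ} (hL₁ : 0 < L₁) (hL : L₁ < L) :
    solutionsPplus L L₁ = branches L {n | 1 ≤ n ∧ rSeq L L₁ n = 0} ∪
      isolatedPlus L L₁ {n | 1 ≤ n ∧ rSeq L L₁ n ≠ 0 ∧ rSeq L L₁ n ≠ -(1 / 2)} := by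
  have hL0 := hL₁.trans hL
  ext z
  rw [mem_union, mem_branches_iff hL0 (fun n hn => hn.1)]
  refine (exists_solvesP_iff (δ := 0) (Or.inl ⟨rfl, rfl⟩) hL₁ hL z).trans ?_
  simp only [add_zero, ← rSeq_eq_zero_iff]
  constructor
  · rintro ⟨n, hn, ω, hω, t, ht, h | h, hz⟩
    · exact Or.inl ⟨n, ⟨hn, h⟩, ω, hω, t, ht, hz⟩
    · have hφ0 := phi_kMod_pos hL0 hn hω
      have hφ1 := phi_lt_one (kMod_mem hL0 hn hω)
      obtain ⟨h0, h1, rfl⟩ := (int_shift_iff_plus (by linarith) (by linarith)).1 h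
      refine Or.inr ⟨n, ⟨hn, h0, h1⟩, ?_⟩
      rw [isolatedPlus_pair_eq, eq_isolated_pair_iff hL0 hn (by linarith) (by linarith)]
      exact ⟨ω, hω, ht, hz⟩
  · rintro (⟨n, ⟨hn, h⟩, ω, hω, t, ht, hz⟩ | ⟨n, ⟨hn, h0, h1⟩, hz⟩)
    · exact ⟨n, hn, ω, hω, t, ht, Or.inl h, hz⟩
    · have hb := abs_rSeq_bounds h0 h1
      rw [← abs_neg] at hb
      rw [isolatedPlus_pair_eq, eq_isolated_pair_iff hL0 hn hb.1 hb.2] at hz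
      obtain ⟨ω, hω, ht, hz⟩ := hz
      exact ⟨n, hn, ω, hω, _, ht, Or.inr ((int_shift_iff_plus hb.1 hb.2).2 ⟨h0, h1, rfl⟩), hz⟩

/-- The solutions of `(P₋)` in terms of the fractional parts `r_n`. -/
theorem solutionsPminus_eq {L L₁ : ℝ} (hL₁ : 0 < L₁) (hL : L₁ < L) :
    solutionsPminus L L₁ = branches L {n | 1 ≤ n ∧ rSeq L L₁ n = -(1 / 2)} ∪
      isolatedMinus L L₁ {n | 1 ≤ n ∧ rSeq L L₁ n ≠ 0 ∧ rSeq L L₁ n ≠ -(1 / 2)} := by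
  have hL0 := hL₁.trans hL
  ext z
  rw [mem_union, mem_branches_iff hL0 (fun n hn => hn.1)]
  refine (exists_solvesP_iff (δ := 1 / 2) (Or.inr ⟨rfl, rfl⟩) hL₁ hL z).trans ?_
  simp only [← rSeq_eq_neg_half_iff]
  constructor
  · rintro ⟨n, hn, ω, hω, t, ht, h, hz⟩
    -- In this case the congruence holds whatever t is, so every ω is admitted; otherwise only the
    -- alternative involving t is left.
    by_cases h1 : rSeq L L₁ n = -(1 / 2)
    · exact Or.inl ⟨n, ⟨hn, h1⟩, ω, hω, t, ht, hz⟩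
    · have hφ0 := phi_kMod_pos hL0 hn hω
      have hφ1 := phi_lt_one (kMod_mem hL0 hn hω)
      obtain ⟨h0, rfl⟩ := (int_shift_iff_minus (by linarith) (by linarith) h1).1
        (h.resolve_left h1)
      refine Or.inr ⟨n, ⟨hn, h0, h1⟩, ?_⟩
      rw [isolatedMinus_pair_eq h0 h1, eq_isolated_pair_iff hL0 hn (by linarith) (by linarith)]
      exact ⟨ω, hω, ht, hz⟩
  · rintro (⟨n, ⟨hn, h⟩, ω, hω, t, ht, hz⟩ | ⟨n, ⟨hn, h0, h1⟩, hz⟩)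
    · exact ⟨n, hn, ω, hω, t, ht, Or.inl h, hz⟩
    · have hb := abs_rSeq_bounds h0 h1
      have he := abs_minus_shift h0 h1
      have hb0 : 0 < |(1 / 2 - |rSeq L L₁ n|) * Real.sign (rSeq L L₁ n)| := by linarith
      have hb1 : |(1 / 2 - |rSeq L L₁ n|) * Real.sign (rSeq L L₁ n)| < 1 / 2 := by linarith
      rw [isolatedMinus_pair_eq h0 h1, eq_isolated_pair_iff hL0 hn hb0 hb1] at hz
      obtain ⟨ω, hω, ht, hz⟩ := hz
      exact ⟨n, hn, ω, hω, _, ht, Or.inr ((int_shift_iff_minus hb0 hb1 h1).2 ⟨h0, rfl⟩), hz⟩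

/-! ### Rational ratios -/

section Arithmetic

variable {L L₁ : ℝ} {p q : ℕ}

theorem rSeq_eq_zero_iff_dvd (hq : 0 < q) (hpq : Nat.Coprime p q)
    (hratio : L₁ / L = (p : ℝ) / (q : ℝ)) {n : ℕ} : rSeq L L₁ n = 0 ↔ q ∣ n := by
  have hq0 : (q : ℝ) ≠ 0 := by positivity
  rw [rSeq_eq_zero_iff, hratio]
  constructor
  · rintro ⟨m, hm⟩
    field_simp at hm
    have h : (p : ℤ) * n = q * m := by exact_mod_cast hm
    have h2 : q ∣ p * n := Int.natCast_dvd_natCast.1 ⟨m, by push_cast; exact h⟩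
    exact hpq.symm.dvd_of_dvd_mul_left h2
  · rintro ⟨m, rfl⟩
    exact ⟨p * m, by push_cast; field_simp⟩

theorem rSeq_eq_neg_half_iff_odd (hq : 0 < q)
    (hratio : L₁ / L = (p : ℝ) / (q : ℝ)) {n : ℕ} :
    rSeq L L₁ n = -(1 / 2) ↔ ∃ m : ℕ, 2 * (p * n) + q = 2 * (q * m) := by
  have hq0 : (0 : ℝ) < q := by exact_mod_cast hq
  rw [rSeq_eq_neg_half_iff, hratio]
  constructor
  · rintro ⟨m, hm⟩
    have hm0 : 0 ≤ m := by
      have : (0 : ℝ) ≤ m := by rw [← hm]; positivity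
      exact_mod_cast this
    lift m to ℕ using hm0
    refine ⟨m, ?_⟩
    field_simp at hm
    push_cast at hm
    have : 2 * ((p : ℝ) * n) + q = 2 * (q * m) := by linarith
    exact_mod_cast this
  · rintro ⟨m, hm⟩
    refine ⟨m, ?_⟩
    have : 2 * ((p : ℝ) * n) + q = 2 * (q * m) := by exact_mod_cast hm
    push_cast
    field_simp
    linarith

theorem mem_multiples_natCast_iff {n : ℕ} : n ∈ multiples (q : ℝ) ↔ 1 ≤ n ∧ q ∣ n := by
  refine and_congr_right fun hn => ⟨?_, ?_⟩
  · rintro ⟨m, -, h⟩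
    exact ⟨m, by rw [mul_comm]; exact_mod_cast h⟩
  · rintro ⟨m, rfl⟩
    exact ⟨m, Nat.pos_of_mul_pos_left hn, by push_cast; ring⟩

theorem exists_half_shift_iff (hq : 0 < q) {n : ℕ} :
    (∃ m : ℕ, 1 ≤ m ∧ (n : ℝ) * p / q + 1 / 2 = m) ↔
      ∃ m : ℕ, 2 * (p * n) + q = 2 * (q * m) := by
  have hq0 : (0 : ℝ) < q := by exact_mod_cast hq
  refine exists_congr fun m => ⟨?_, fun h => ⟨?_, ?_⟩⟩
  · rintro ⟨-, h⟩
    field_simp at h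
    have : 2 * ((p : ℝ) * n) + q = 2 * (q * m) := by linarith
    exact_mod_cast this
  · rcases Nat.eq_zero_or_pos m with rfl | hm
    · omega
    · exact hm
  · have : 2 * ((p : ℝ) * n) + q = 2 * (q * m) := by exact_mod_cast h
    field_simp
    linarith

/-- Write q = 2d; then p is odd and prime to d. The equation becomes pn + d = 2dm, which forces n =
dj with pj odd, that is, j odd. -/
theorem mem_oddMultiples_half_iff (hq : 0 < q) (hpq : Nat.Coprime p q) (hqe : Even q) {n : ℕ} :
    n ∈ oddMultiples ((q : ℝ) / 2) ↔ 1 ≤ n ∧ ∃ m : ℕ, 2 * (p * n) + q = 2 * (q * m) := by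
  obtain ⟨d, rfl⟩ := hqe
  have hd : 0 < d := by omega
  have hpd : Nat.Coprime p d := Nat.Coprime.coprime_dvd_right ⟨2, by ring⟩ hpq
  have hpodd : Odd p :=
    Nat.coprime_two_right.1 (Nat.Coprime.coprime_dvd_right ⟨d, by ring⟩ hpq)
  refine and_congr_right fun hn => ⟨?_, ?_⟩
  · rintro ⟨m, hm, h⟩
    obtain ⟨e, rfl⟩ := hpodd
    obtain ⟨i, rfl⟩ := Nat.exists_eq_add_of_le hm
    have hnd : n = (2 * i + 1) * d := by
      have : (n : ℝ) = (2 * i + 1) * d := by rw [h]; push_cast; ring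
      exact_mod_cast this
    exact ⟨(2 * e + 1) * i + e + 1, by rw [hnd]; ring⟩
  · rintro ⟨m, hm⟩
    have hm' : p * n + d = d * (2 * m) := by linarith
    have hdvd : d ∣ p * n := (Nat.dvd_add_left (dvd_refl d)).1 ⟨2 * m, hm'⟩
    obtain ⟨j, rfl⟩ := hpd.symm.dvd_of_dvd_mul_left hdvd
    have hpj : p * j + 1 = 2 * m := Nat.eq_of_mul_eq_mul_left hd (by linarith)
    have hj : Odd j := by
      have : Odd (p * j) := by
        rw [← Nat.not_even_iff_odd]
        rintro ⟨c, hc⟩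
        omega
      exact (Nat.odd_mul.1 this).2
    obtain ⟨i, rfl⟩ := hj
    exact ⟨i + 1, by omega, by push_cast; ring⟩

/-- Even multiples of q/2 are the multiples of q, where `rSeq` is 0; odd multiples are those where
it is -1/2. Isolated solutions of the minus problem must avoid both. -/
theorem mem_multiples_half_iff (hq : 0 < q) (hpq : Nat.Coprime p q) (hqe : Even q) {n : ℕ} :
    n ∈ multiples ((q : ℝ) / 2) ↔
      1 ≤ n ∧ (q ∣ n ∨ ∃ m : ℕ, 2 * (p * n) + q = 2 * (q * m)) := by
  have hodd := mem_oddMultiples_half_iff (n := n) hq hpq hqe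
  refine and_congr_right fun hn => ⟨?_, ?_⟩
  · rintro ⟨m, -, h⟩
    rcases Nat.even_or_odd m with ⟨i, rfl⟩ | ⟨i, rfl⟩
    · refine Or.inl ⟨i, ?_⟩
      have : (n : ℝ) = q * i := by rw [h]; push_cast; ring
      exact_mod_cast this
    · exact Or.inr (hodd.1 ⟨hn, i + 1, by omega, by rw [h]; push_cast; ring⟩).2
  · rintro (⟨c, rfl⟩ | h)
    · have hc : 0 < c := Nat.pos_of_mul_pos_left hn
      exact ⟨2 * c, by omega, by push_cast; ring⟩
    · obtain ⟨-, m, hm, h⟩ := hodd.2 ⟨hn, h⟩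
      refine ⟨2 * m - 1, by omega, ?_⟩
      rw [h, Nat.cast_sub (by omega)]
      push_cast
      ring

end Arithmetic

end DoubleBridge

/-! ### The theorem for rational ratios -/

open DoubleBridge
theorem theorem2 (L L₁ : ℝ) (hL₁ : 0 < L₁) (hL : L₁ < L)
    (p q : ℕ) (hp : 0 < p) (hq : 0 < q) (hpq : Nat.Coprime p q)
    (hratio : L₁ / L = (p : ℝ) / (q : ℝ)) :
    solutionsPplus L L₁ =
        branches L (multiples (q : ℝ)) ∪
          isolatedPlus L L₁ {n : ℕ | 1 ≤ n ∧ n ∉ multiples (q : ℝ) ∧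
            ¬ ∃ m : ℕ, 1 ≤ m ∧ (n : ℝ) * p / q + 1 / 2 = m} ∧
      (Odd q →
        solutionsPminus L L₁ =
          isolatedMinus L L₁ {n : ℕ | 1 ≤ n ∧ n ∉ multiples (q : ℝ)}) ∧
      (Even q →
        solutionsPminus L L₁ =
          branches L (oddMultiples ((q : ℝ) / 2)) ∪
            isolatedMinus L L₁ {n : ℕ | 1 ≤ n ∧ n ∉ multiples ((q : ℝ) / 2)}) := by
  have hzero : ∀ n, rSeq L L₁ n = 0 ↔ q ∣ n := fun n => rSeq_eq_zero_iff_dvd hq hpq hratio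
  have hhalf : ∀ n, rSeq L L₁ n = -(1 / 2) ↔ ∃ m : ℕ, 2 * (p * n) + q = 2 * (q * m) :=
    fun n => rSeq_eq_neg_half_iff_odd hq hratio
  refine ⟨?_, fun hqo => ?_, fun hqe => ?_⟩
  · rw [solutionsPplus_eq hL₁ hL]
    congr 2 <;> ext n <;>
      simp only [mem_ofPred_eq, mem_multiples_natCast_iff, exists_half_shift_iff hq, hzero, hhalf,
        ne_eq]
    tauto
  -- For odd q the number 2pn + q is odd and cannot equal 2qm, so the minus problem has no branches.
  · have hne : ∀ n, rSeq L L₁ n ≠ -(1 / 2) := fun n h => by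
      obtain ⟨m, hm⟩ := (hhalf n).1 h
      obtain ⟨d, rfl⟩ := hqo
      omega
    rw [solutionsPminus_eq hL₁ hL]
    have hempty : branches L {n | 1 ≤ n ∧ rSeq L L₁ n = -(1 / 2)} = ∅ :=
      eq_empty_of_forall_notMem fun z hz => by
        obtain ⟨n, hn, -⟩ := hz
        exact hne n hn.2
    rw [hempty, empty_union]
    congr 1
    ext n
    simp only [mem_ofPred_eq, mem_multiples_natCast_iff, hzero, hne, ne_eq, not_false_eq_true]
    tauto
  · rw [solutionsPminus_eq hL₁ hL]
    congr 2 <;> ext n <;>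
      simp only [mem_ofPred_eq, mem_multiples_half_iff hq hpq hqe,
        mem_oddMultiples_half_iff hq hpq hqe, hzero, hhalf, ne_eq]
    tauto
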